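/- Let $\Phi\subset\mathfrak h^*$ be an irreducible (reduced, crystallographic) root system of rank $n$ in the dual of a complex vector space $\mathfrak h$, with coroots $\Phi^\vee\subset\mathfrak h$ and Weyl group $W$. Let $T=\mathfrak h/\langle\Phi^\vee\rangle$ be the quotient of $\mathfrak h$ by the lattice spanned by the coroots, with its natural $W$-action. Each root $\alpha$ takes integer values on $\langle\Phi^\vee\rangle$, hence induces a character $e^\alpha:T\to\mathbb C/\mathbb Z\simeq\mathbb C^*$; put $H_\alpha=\{t\in T: e^\alpha(t)=1\}$. The layers of the toric arrangement $\{H_\alpha\}_{\alpha\in\Phi}$ are the connected components of the intersections of the $H_\alpha$, and $\mathcal C_0(\Phi)$ is the ($W$-stable) set of the $0$-dimensional layers, i.e. of the points $t\in T$ such that $\{t\}$ is a layer. For $t\in T$ let $\Phi(t)=\{\alpha\in\Phi: e^\alpha(t)=1\}$ and let $W(t)$ be the stabilizer of $t$ in $W$. A subset $\Theta\subseteq\Phi$ is a subsystem if $\alpha\in\Theta$ implies $-\alpha\in\Theta$, and $\alpha,\beta\in\Theta$, $\alpha+\beta\in\Phi$ imply $\alpha+\beta\in\Theta$. Let $\alpha_1,\dots,\alpha_n$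 be simple roots of $\Phi$, let $\alpha_0$ be the lowest root, and identify the set $V(\Gamma)$ of the vertices of the affine Dynkin diagram $\Gamma$ of $\Phi$ with $\{0,1,\dots,n\}$. For $p\in V(\Gamma)$ let $\Phi_p$ be the subsystem generated by the $\alpha_i$ with $0\le i\le n$, $i\ne p$ (the smallest subsystem containing them), and let $W_p\subseteq W$ be the subgroup generated by the reflections $s_{\alpha_i}$ with $0\le i\le n$, $i\neq p$. **Theorem.** There is a bijection $p\mapsto\mathcal O_p$ from the vertices of $\Gamma$ to the $W$-orbits of $\mathcal C_0(\Phi)$ such that, for every vertex $p$ and every point $t\in\mathcal O_p$, $\Phi(t)$ is $W$-conjugate to $\Phi_p$ and $W(t)$ is $W$-conjugate to $W_p$. Moreover, $\mathcal C_0(\Phi)$ is finite and $$|\mathcal C_0(\Phi)|=\sum_{p\in V(\Gamma)}\frac{|W|}{|W_p|}.$$ -/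

import Mathlib

open Topology

noncomputable section

namespace RootPairing

section LowestRoot

variable {ι M N : Type*} [Finite ι] [AddCommGroup M] [Module ℂ M] [AddCommGroup N] [Module ℂ N]
  {P : RootPairing ι ℂ M N} [P.IsCrystallographic]

theorem Base.mem_closure_of_isPos (b : P.Base) {i : ι} (hi : b.IsPos i) :
    P.root i ∈ AddSubmonoid.closure (P.root '' b.support) := by
  refine hi.induction_on_add (p := fun i => P.root i ∈ AddSubmonoid.closure (P.root '' b.support))
    (fun j hj => AddSubmonoid.subset_closure ⟨j, hj, rfl⟩) ?_
  intro j k l h h₁ h₂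
  rw [h]
  exact add_mem h₁ (AddSubmonoid.subset_closure ⟨k, h₂, rfl⟩)

/-- A positive root to which no simple root can be added pairs non-negatively with the simple
coroots. -/
theorem Base.pairingIn_nonneg_of_isMax (b : P.Base) {i : ι} (hi : b.IsPos i)
    (hmax : ∀ j ∈ b.support, ∀ k, P.root k ≠ P.root i + P.root j) {j : ι} (hj : j ∈ b.support) :
    0 ≤ P.pairingIn ℤ i j := by
  by_contra! h
  by_cases hne : P.root i = - P.root j
  · let := P.indexNeg
    have h1 : i = -j := P.root.injective (by simpa using hne)
    have h2 := b.height_reflectionPerm_self j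
    rw [← h1, Base.height_one_of_mem_support hj] at h2
    have h3 := (b.isPos_iff (i := i)).mp hi
    lia
  · obtain ⟨k, hk⟩ := P.root_add_root_mem_of_pairingIn_neg h hne
    exact hmax j hj k hk

theorem Base.pairingIn_eq_sum (b : P.Base) {i : ι} {f : ι → ℤ}
    (hf : P.root i = ∑ j ∈ b.support, f j • P.root j) (k : ι) :
    P.pairingIn ℤ i k = ∑ j ∈ b.support, f j * P.pairingIn ℤ j k := by
  refine FaithfulSMul.algebraMap_injective ℤ ℂ ?_
  simp_rw [map_sum, map_mul, algebraMap_pairingIn, ← root_coroot_eq_pairing, hf, map_sum, map_zsmul,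
    LinearMap.coe_sum, Finset.sum_apply, LinearMap.smul_apply, zsmul_eq_mul]
  simp

theorem Base.exists_highest [P.IsRootSystem] [P.IsReduced] [P.IsIrreducible] (b : P.Base) :
    ∃ i, ∀ j, P.root i - P.root j ∈ AddSubmonoid.closure (P.root '' b.support) := by
  classical
  let := P.indexNeg
  have hne : Nonempty ι := by
    by_contra h
    rw [not_nonempty_iff] at h
    have h1 := IsRootSystem.span_root_eq_top (P := P)
    have h2 := IsIrreducible.nontrivial P
    rw [Set.range_eq_empty, Submodule.span_empty] at h1
    exact bot_ne_top h1
  obtain ⟨θ, hθ⟩ := Finite.exists_max b.height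
  obtain ⟨s, hs⟩ := b.support_nonempty
  have hθpos : b.IsPos θ := by
    have := hθ s
    rw [Base.height_one_of_mem_support hs] at this
    exact b.isPos_iff.mpr (by lia)
  have hθmem := b.mem_closure_of_isPos hθpos
  have hθdom : ∀ j ∈ b.support, 0 ≤ P.pairingIn ℤ θ j := fun j hj =>
    b.pairingIn_nonneg_of_isMax hθpos (fun k hk l hl => by
      have h1 := b.height_add hl
      rw [Base.height_one_of_mem_support hk] at h1
      have := hθ l
      lia) hj
  obtain ⟨f, -, hf, hfe⟩ := b.exists_root_eq_sum_int θ
  have hf0 : 0 < f := by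
    refine hf.resolve_right fun h => ?_
    have h1 := (b.isPos_iff (i := θ)).mp hθpos
    rw [Base.height_eq_sum hfe] at h1
    exact absurd (Finset.sum_nonpos fun i _ => h.le i) (not_le.mpr h1)
  have hfpos : ∀ j : b.support, 0 < f j := by
    obtain ⟨i, hi⟩ : ∃ i : b.support, 0 < f i := by
      by_contra! h
      apply P.ne_zero θ
      rw [hfe]
      refine Finset.sum_eq_zero fun j hj => ?_
      rw [le_antisymm (h ⟨j, hj⟩) (hf0.le j)]
      simp
    intro j
    refine b.induction_on_cartanMatrix (fun j => 0 < f j) hi ?_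
    intro i j hi hij
    by_contra hj
    have hj0 : f j = 0 := le_antisymm (not_lt.mp hj) (hf0.le j)
    have hne : (i : ι) ≠ j := fun h => by rw [h, hj0] at hi; exact lt_irrefl _ hi
    have hlt : P.pairingIn ℤ i j < 0 := by
      refine lt_of_le_of_ne (b.pairingIn_le_zero_of_ne hne i.2 j.2) fun h => hij ?_
      rw [Base.cartanMatrix_apply_eq_zero_iff_symm]
      exact h
    have h1 := hθdom j j.2
    rw [b.pairingIn_eq_sum hfe] at h1
    refine absurd h1 (not_le.mpr ?_)
    refine Finset.sum_neg' (fun k hk => ?_) ⟨i, i.2, mul_neg_of_pos_of_neg hi hlt⟩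
    by_cases hkj : k = j
    · simp [hkj, hj0]
    · exact mul_nonpos_of_nonneg_of_nonpos (hf0.le k) (b.pairingIn_le_zero_of_ne hkj hk j.2)
  have key : ∀ j, b.IsPos j → P.root θ - P.root j ∈ AddSubmonoid.closure (P.root '' b.support) := by
    intro j hj
    have : Nonempty {k : ι // P.root k - P.root j ∈ AddSubmonoid.closure (P.root '' b.support) ∧
        b.IsPos k} := ⟨⟨j, by simp, hj⟩⟩
    obtain ⟨⟨β, hβ, hβpos⟩, hβmax⟩ := Finite.exists_max (fun k : {k : ι // P.root k - P.root j ∈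
      AddSubmonoid.closure (P.root '' b.support) ∧ b.IsPos k} => b.height k)
    have hβdom : ∀ k ∈ b.support, 0 ≤ P.pairingIn ℤ β k := fun k hk =>
      b.pairingIn_nonneg_of_isMax hβpos (fun m hm l hl => by
        have h1 := b.height_add hl
        have h2 := hβmax ⟨l, by
          rw [hl, add_sub_right_comm]
          exact add_mem hβ (AddSubmonoid.subset_closure ⟨m, hm, rfl⟩),
          hβpos.add (Base.isPos_of_mem_support hm) hl⟩
        rw [Base.height_one_of_mem_support hm] at h1
        simp only at h2
        lia) hk
    have hsum : 0 < P.pairingIn ℤ θ β := by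
      rw [b.pairingIn_eq_sum hfe]
      obtain ⟨k, hk, hk0⟩ := hβpos.exists_mem_support_pos_pairingIn
      refine Finset.sum_pos' (fun m hm => mul_nonneg (hf0.le m) ?_)
        ⟨k, hk, mul_pos (hfpos ⟨k, hk⟩) hk0⟩
      by_contra! h
      rw [P.pairingIn_lt_zero_iff] at h
      exact absurd (hβdom m hm) (not_le.mpr h)
    by_cases hθβ : θ = β
    · rw [hθβ]; exact hβ
    · obtain ⟨γ, hγ⟩ := P.root_sub_root_mem_of_pairingIn_pos hsum hθβ
      have hγpos : b.IsPos γ := by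
        rw [b.isPos_iff', b.height_sub hγ]
        have := hθ β
        lia
      have h1 := add_mem (b.mem_closure_of_isPos hγpos) hβ
      rwa [hγ, sub_add_sub_cancel] at h1
  refine ⟨θ, fun j => ?_⟩
  rcases Base.IsPos.or_neg b j with hj | hj
  · exact key j hj
  · have h1 := add_mem hθmem (b.mem_closure_of_isPos hj)
    simpa [sub_eq_add_neg] using h1

theorem Base.exists_lowest [P.IsRootSystem] [P.IsReduced] [P.IsIrreducible] (b : P.Base) :
    ∃ i, ∀ j, P.root j - P.root i ∈ AddSubmonoid.closure (P.root '' b.support) := by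
  obtain ⟨i, hi⟩ := b.exists_highest
  refine ⟨P.reflectionPerm i i, fun j => ?_⟩
  have := hi (P.reflectionPerm j j)
  simpa [add_comm] using this

/-- (The index of) the lowest root `α₀` with respect to a base of an irreducible root system: the
root such that every root is obtained from it by adding simple roots. -/
def Base.lowestRoot [P.IsRootSystem] [P.IsReduced] [P.IsIrreducible] (b : P.Base) : ι :=
  b.exists_lowest.choose

theorem Base.sub_lowestRoot_mem [P.IsRootSystem] [P.IsReduced] [P.IsIrreducible] (b : P.Base)
    (j : ι) :
    P.root j - P.root b.lowestRoot ∈ AddSubmonoid.closure (P.root '' b.support) :=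
  b.exists_lowest.choose_spec j

end LowestRoot

section Torus

variable {ι M N : Type*} [AddCommGroup M] [Module ℂ M] [AddCommGroup N] [Module ℂ N]
  (P : RootPairing ι ℂ M N)

/-- The lattice `⟨Φ^∨⟩` spanned by the coroots. -/
def corootLattice : AddSubgroup N := AddSubgroup.closure (Set.range P.coroot)

/-- The complex torus `T = 𝔥 / ⟨Φ^∨⟩`. -/
abbrev Torus : Type _ := N ⧸ P.corootLattice

/-- The action of an element of the Weyl group on `𝔥` (contragredient to its action on `𝔥*`). -/
def coweightAct (w : P.weylGroup) : N ≃ₗ[ℂ] N := Equiv.coweightEquiv P P (w⁻¹ : P.weylGroup).1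

theorem coweightAct_one : P.coweightAct 1 = 1 := by
  ext x; simp [coweightAct]

theorem coweightAct_mul (v w : P.weylGroup) :
    P.coweightAct (v * w) = P.coweightAct v * P.coweightAct w := by
  ext x; simp [coweightAct]

/-- The action on `𝔥` is the one for which the pairing of `𝔥*` and `𝔥` is invariant. -/
theorem toLinearMap_smul_coweightAct (w : P.weylGroup) (x : M) (h : N) :
    P.toLinearMap (w • x) (P.coweightAct w h) = P.toLinearMap x h := by
  have h1 := Hom.weight_coweight_transpose_apply P P (P.coweightAct w h) w.1.toHom
  have h2 := LinearMap.congr_fun h1 x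
  have h3 : w.1.toHom.coweightMap (P.coweightAct w h) = h := by
    simp [coweightAct]
  rw [h3] at h2
  exact h2

theorem coweightAct_coroot (w : P.weylGroup) (i : ι) :
    P.coweightAct w (P.coroot i) = P.coroot (P.weylGroupToPerm w i) := by
  have := Hom.coroot_coweightMap_apply P P i (w⁻¹ : P.weylGroup).1.toHom
  simpa [coweightAct] using! this

theorem corootLattice_le_comap (w : P.weylGroup) :
    P.corootLattice ≤ P.corootLattice.comap (P.coweightAct w).toLinearMap.toAddMonoidHom := by
  rw [corootLattice, AddSubgroup.closure_le]
  rintro _ ⟨i, rfl⟩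
  refine AddSubgroup.subset_closure ⟨P.weylGroupToPerm w i, ?_⟩
  exact (P.coweightAct_coroot w i).symm

/-- The natural action of the Weyl group `W` on the torus `T`. -/
instance torusMulAction : MulAction P.weylGroup P.Torus where
  smul w := QuotientAddGroup.map _ _ (P.coweightAct w).toLinearMap.toAddMonoidHom
    (P.corootLattice_le_comap w)
  one_smul t := by
    induction t using QuotientAddGroup.induction_on with
    | H h =>
      change QuotientAddGroup.mk (P.coweightAct 1 h) = _
      rw [coweightAct_one]; rfl
  mul_smul v w t := by
    induction t using QuotientAddGroup.induction_on with
    | H h =>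
      change QuotientAddGroup.mk (P.coweightAct (v * w) h) =
        QuotientAddGroup.mk (P.coweightAct v (P.coweightAct w h))
      rw [coweightAct_mul]; rfl

theorem smul_torus_mk (w : P.weylGroup) (h : N) :
    w • (h : P.Torus) = ((P.coweightAct w h : N) : P.Torus) := rfl

theorem corootLattice_le_comap_root' [P.IsCrystallographic] (i : ι) :
    P.corootLattice ≤
      (AddSubgroup.zmultiples (1 : ℂ)).comap (P.root' i).toAddMonoidHom := by
  rw [corootLattice, AddSubgroup.closure_le]
  rintro _ ⟨j, rfl⟩
  refine AddSubgroup.mem_zmultiples_iff.mpr ⟨P.pairingIn ℤ i j, ?_⟩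
  have := P.algebraMap_pairingIn ℤ i j
  simpa using this

/-- The character `e^α : T → ℂ / ℤ ≃ ℂ*` induced by the root `α` (written additively, so that
`e^α (t) = 1` reads `P.rootChar i t = 0`). -/
def rootChar [P.IsCrystallographic] (i : ι) : P.Torus →+ ℂ ⧸ AddSubgroup.zmultiples (1 : ℂ) :=
  QuotientAddGroup.map _ _ (P.root' i).toAddMonoidHom (P.corootLattice_le_comap_root' i)

/-- The hypersurface `H_α`, the kernel of `e^α`, for `α` the root of index `i`. -/
def hypersurface [P.IsCrystallographic] (i : ι) : Set P.Torus := {t | P.rootChar i t = 0}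

/-- (The set of indices of) the subsystem `Φ(t) = {α ∈ Φ | e^α (t) = 1}`. -/
def rootsAt [P.IsCrystallographic] (t : P.Torus) : Set ι := {i | P.rootChar i t = 0}

/-- The layers of the toric arrangement: the connected components of the intersections of the
hypersurfaces `H_α`. -/
def IsLayer [P.IsCrystallographic] [TopologicalSpace N] (C : Set P.Torus) : Prop :=
  ∃ S : Set ι, ∃ t ∈ ⋂ i ∈ S, P.hypersurface i,
    C = connectedComponentIn (⋂ i ∈ S, P.hypersurface i) t

theorem rootChar_smul [P.IsCrystallographic] (w : P.weylGroup) (i : ι) (t : P.Torus) :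
    P.rootChar (P.weylGroupToPerm w i) (w • t) = P.rootChar i t := by
  induction t using QuotientAddGroup.induction_on with
  | H h =>
    change QuotientAddGroup.mk (P.toLinearMap (P.root (P.weylGroupToPerm w i))
      (P.coweightAct w h)) = QuotientAddGroup.mk (P.toLinearMap (P.root i) h)
    rw [← weylGroup_apply_root, toLinearMap_smul_coweightAct]

theorem continuous_smul_torus [Finite ι] [P.IsRootSystem] [TopologicalSpace N]
    [IsTopologicalAddGroup N] [ContinuousSMul ℂ N] [T2Space N] (w : P.weylGroup) :
    Continuous (fun t : P.Torus => w • t) := by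
  have hfin : FiniteDimensional ℂ N := by
    refine ⟨⟨(Set.finite_range P.coroot).toFinset, ?_⟩⟩
    simp
  have h1 : Continuous (P.coweightAct w) :=
    LinearMap.continuous_of_finiteDimensional (P.coweightAct w).toLinearMap
  exact continuous_quot_lift _ (continuous_quot_mk.comp h1)

/-- The set `C₀(Φ)` of the 0-dimensional layers, identified with the points of `T` that they
consist of, with the action of the Weyl group. (A layer is connected, and a translate of a subtorus
of `T`: it has dimension 0 if and only if it is a single point.) -/
def points [Finite ι] [P.IsCrystallographic] [P.IsRootSystem] [TopologicalSpace N]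
    [IsTopologicalAddGroup N] [ContinuousSMul ℂ N] [T2Space N] :
    SubMulAction P.weylGroup P.Torus where
  carrier := {t | P.IsLayer {t}}
  smul_mem' := by
    rintro w t ⟨S, s, hs, hC⟩
    have hst : t = s := by
      have := mem_connectedComponentIn hs
      rw [← hC] at this
      exact (Set.mem_singleton_iff.mp this).symm
    subst hst
    let e : P.Torus ≃ₜ P.Torus :=
      { toEquiv := MulAction.toPerm w
        continuous_toFun := P.continuous_smul_torus w
        continuous_invFun := P.continuous_smul_torus w⁻¹ }
    have himg : e '' (⋂ i ∈ S, P.hypersurface i) =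
        ⋂ i ∈ P.weylGroupToPerm w '' S, P.hypersurface i := by
      ext u
      rw [e.image_eq_preimage_symm]
      simp only [Set.mem_preimage, Set.mem_iInter, Set.forall_mem_image, hypersurface,
        Set.mem_ofPred_eq]
      refine forall₂_congr fun i _ => ?_
      have h1 : w • e.symm u = u := e.apply_symm_apply u
      rw [← P.rootChar_smul w i (e.symm u), h1]
    refine ⟨P.weylGroupToPerm w '' S, w • t, ?_, ?_⟩
    · rw [← himg]; exact ⟨t, hs, rfl⟩
    · rw [← himg]
      have h2 := e.image_connectedComponentIn hs
      rw [← hC, Set.image_singleton] at h2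
      exact h2

/-- A set of roots (given by their indices) is a subsystem if it is closed under taking opposites
and under those sums that are roots. -/
def IsSubsystem (Θ : Set ι) : Prop :=
  (∀ i ∈ Θ, ∀ j, P.root j = -P.root i → j ∈ Θ) ∧
    ∀ i ∈ Θ, ∀ j ∈ Θ, ∀ k, P.root k = P.root i + P.root j → k ∈ Θ

/-- The subsystem generated by a set of roots: the smallest one that contains it. -/
def subsystemClosure (S : Set ι) : Set ι := ⋂₀ {Θ | P.IsSubsystem Θ ∧ S ⊆ Θ}

end Torus

section AffineDiagram

variable {ι M N : Type*} [Finite ι] [AddCommGroup M] [Module ℂ M] [AddCommGroup N] [Module ℂ N]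
  {P : RootPairing ι ℂ M N} [P.IsCrystallographic] [P.IsRootSystem] [P.IsReduced] [P.IsIrreducible]

/-- The vertices of the affine Dynkin diagram `Γ`: the vertex `0` (`none`) and one vertex for each
simple root. -/
abbrev Base.AffineVertex (b : P.Base) : Type _ := Option b.support

/-- (The index of) the root `α_p` attached to the vertex `p` of `Γ`: the lowest root for `p = 0`,
a simple root otherwise. -/
def Base.affineSimpleRoot (b : P.Base) : b.AffineVertex → ι
  | none => b.lowestRoot
  | some j => j

/-- (The set of indices of) the subsystem `Φ_p` generated by the `α_q` with `q ≠ p`. -/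
def Base.subsystemAt (b : P.Base) (p : b.AffineVertex) : Set ι :=
  P.subsystemClosure (b.affineSimpleRoot '' {q | q ≠ p})

/-- The Weyl group `W_p` of `Φ_p`: the subgroup of `W` generated by the reflections in the `α_q`
with `q ≠ p`. -/
def Base.weylGroupAt (b : P.Base) (p : b.AffineVertex) : Subgroup P.weylGroup :=
  Subgroup.closure ((fun q => weylGroup.ofIdx P (b.affineSimpleRoot q)) '' {q | q ≠ p})

end AffineDiagram

end RootPairing

end

/-! ### Abstract reflection systems: exchange condition and fundamental domain. -/

noncomputable section

open scoped ComplexOrder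

/-! Being a 0-dimensional layer is a rank condition: {t} is a layer exactly when the roots in Φ(t)
have no common zero in 𝔥 except 0 (`Separates`, `mem_points_iff`). If x lifts such a t, every root
is real at x (`im_root'_eq_zero`), so the affine Weyl group W ⋉ ⟨Φ^∨⟩ can move x into the
fundamental alcove, cut out by α_i ≥ 0 for i ≥ 1 and α_0 + 1 ≥ 0. A point of the alcove whose
integral roots separate points lies on all walls but one, hence is one of the n + 1 vertices of the
alcove (`eq_alcoveVertex_of_separates`).

The alcove meets each orbit of the affine Weyl group at most once, and the stabilizer of one of its
points is generated by the reflections in the walls through that point (`apply_eq_of_mem_alcove`).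
Taking linear parts, the stabilizer in W of the vertex opposite to the wall p is W_p. A positive
affine root vanishing at this vertex is a sum of simple affine roots that vanish there, whence Φ(t)
= Φ_p. So vertices of Γ, vertices of the alcove and W-orbits of 𝒞₀(Φ) correspond, and the count is
the orbit-stabilizer formula.

Values of roots are complex and compared by `ComplexOrder`, where 0 ≤ z entails that z is real: the
alcove lies in the real span of the coroots, and comparability of values with 0 has to be proved. -/

/-- Reflections `s q` of a set `X` attached to simple elements `simple q` of a set `Ψ` of functions
on `X` such that each `s q` permutes the positive elements of `Ψ` other than `simple q`. -/
structure SimpleReflectionSystem (Q Ψ X : Type*) where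
  /-- The function attached to an element of `Ψ`. -/
  eval : Ψ → X → ℂ
  /-- The reflection attached to an element of `Ψ`. -/
  refl : Ψ → Equiv.Perm X
  /-- The simple elements. -/
  simple : Q → Ψ
  /-- The action of the simple reflections on `Ψ`. -/
  act : Q → Ψ → Ψ
  /-- The positive elements. -/
  Pos : Ψ → Prop
  eval_act : ∀ q a x, eval (act q a) x = eval a (refl (simple q) x)
  refl_act : ∀ q a, refl (act q a) = refl (simple q) * refl a * refl (simple q)
  act_act : ∀ q a, act q (act q a) = a
  refl_mul_self : ∀ q, refl (simple q) * refl (simple q) = 1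
  eval_refl : ∀ q x, eval (simple q) (refl (simple q) x) = -eval (simple q) x
  refl_eq_self : ∀ q x, eval (simple q) x = 0 → refl (simple q) x = x
  pos_simple : ∀ q, Pos (simple q)
  not_pos_act_simple : ∀ q, ¬ Pos (act q (simple q))
  pos_act : ∀ q a, Pos a → a ≠ simple q → Pos (act q a)
  eval_nonneg : ∀ a x, Pos a → (∀ q, 0 ≤ eval (simple q) x) → 0 ≤ eval a x

namespace SimpleReflectionSystem

variable {Q Ψ X : Type*} (S : SimpleReflectionSystem Q Ψ X)

/-- The simple reflections. -/
def s (q : Q) : Equiv.Perm X := S.refl (S.simple q)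

/-- The closed fundamental domain. -/
def alcove : Set X := {x | ∀ q, 0 ≤ S.eval (S.simple q) x}

/-- The permutation of `X` given by a word in the simple reflections. -/
def word (l : List Q) : Equiv.Perm X := (l.map S.s).prod

/-- The action on `Ψ` of the inverse of a word. -/
def wordAct : List Q → Ψ → Ψ
  | [], a => a
  | q :: l, a => wordAct l (S.act q a)

theorem word_cons (q : Q) (l : List Q) : S.word (q :: l) = S.s q * S.word l := by
  simp [word]

theorem eval_wordAct (l : List Q) (a : Ψ) (x : X) :
    S.eval (S.wordAct l a) x = S.eval a (S.word l x) := by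
  induction l generalizing a with
  | nil => simp [wordAct, word]
  | cons q l ih => rw [wordAct, ih, S.eval_act, word_cons, Equiv.Perm.mul_apply, s]

/-- Exchange condition. Along the word the positive element `a` stops being positive, which can only
happen at a letter whose simple element it has become; that letter cancels against `refl a`. -/
theorem exists_shorter_word (l : List Q) (a : Ψ) (ha : S.Pos a) (hl : ¬ S.Pos (S.wordAct l a)) :
    ∃ l' : List Q, l'.length < l.length ∧ S.refl a * S.word l = S.word l' := by
  induction l generalizing a with
  | nil => exact absurd ha hl
  | cons q l ih =>
    by_cases h : a = S.simple q
    · refine ⟨l, by simp, ?_⟩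
      rw [h, word_cons, s, ← mul_assoc, S.refl_mul_self, one_mul]
    · obtain ⟨l', hlt, he⟩ := ih (S.act q a) (S.pos_act q a ha h) hl
      refine ⟨q :: l', by simpa using hlt, ?_⟩
      rw [word_cons, word_cons, ← he, S.refl_act, s]
      simp only [← mul_assoc, S.refl_mul_self, one_mul]

/-- Induction on the length of the word `q :: l`. If `l` pulls the simple element of `q` back to a
positive one, its value at `word l x` is both ≥ 0 and ≤ 0, so `s q` fixes that point and contributes
a reflection in a wall through `x`. Otherwise the exchange condition shortens the word. -/
theorem word_apply_eq_of_mem_alcove (l : List Q) {x : X} (hx : x ∈ S.alcove)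
    (hlx : S.word l x ∈ S.alcove) :
    S.word l x = x ∧ S.word l ∈ Subgroup.closure (S.s '' {q | S.eval (S.simple q) x = 0}) := by
  induction hn : l.length using Nat.strong_induction_on generalizing l with
  | _ n ih =>
    subst hn
    cases l with
    | nil => simp [word, one_mem]
    | cons q l =>
      by_cases hp : S.Pos (S.wordAct l (S.simple q))
      · have h1 : 0 ≤ S.eval (S.simple q) (S.word l x) := by
          rw [← eval_wordAct]
          exact S.eval_nonneg _ _ hp hx
        have h2 := hlx q
        rw [word_cons, Equiv.Perm.mul_apply, s, S.eval_refl] at h2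
        have h3 : S.eval (S.simple q) (S.word l x) = 0 := le_antisymm (neg_nonneg.mp h2) h1
        have h4 : S.word (q :: l) x = S.word l x := by
          rw [word_cons, Equiv.Perm.mul_apply, s, S.refl_eq_self q _ h3]
        rw [h4] at hlx
        obtain ⟨h5, h6⟩ := ih l.length (by simp) l hlx rfl
        rw [h5] at h3 h4
        refine ⟨h4, ?_⟩
        rw [word_cons]
        exact mul_mem (Subgroup.subset_closure ⟨q, h3, rfl⟩) h6
      · obtain ⟨l', hlt, he⟩ := S.exists_shorter_word l _ (S.pos_simple q) hp
        have h1 : S.word (q :: l) = S.word l' := by rw [word_cons, s, he]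
        rw [h1] at hlx ⊢
        exact ih l'.length (by simp; omega) l' hlx rfl

theorem exists_word_eq {g : Equiv.Perm X} (hg : g ∈ Subgroup.closure (Set.range S.s)) :
    ∃ l, S.word l = g := by
  have hinv : ∀ q, (S.s q)⁻¹ = S.s q := fun q => inv_eq_of_mul_eq_one_left (S.refl_mul_self q)
  induction hg using Subgroup.closure_induction'' with
  | one => exact ⟨[], rfl⟩
  | mem g hg =>
    obtain ⟨q, rfl⟩ := hg
    exact ⟨[q], by simp [word]⟩
  | inv_mem g hg =>
    obtain ⟨q, rfl⟩ := hg
    exact ⟨[q], by simp [word, hinv]⟩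
  | mul g h _ _ hg hh =>
    obtain ⟨l, rfl⟩ := hg
    obtain ⟨m, rfl⟩ := hh
    exact ⟨l ++ m, by simp [word]⟩

/-- The closed alcove meets every orbit of the group generated by the simple reflections at most
once, and stabilizers of its points are generated by simple reflections. -/
theorem apply_eq_of_mem_alcove {g : Equiv.Perm X} (hg : g ∈ Subgroup.closure (Set.range S.s))
    {x : X} (hx : x ∈ S.alcove) (hgx : g x ∈ S.alcove) :
    g x = x ∧ g ∈ Subgroup.closure (S.s '' {q | S.eval (S.simple q) x = 0}) := by
  obtain ⟨l, rfl⟩ := S.exists_word_eq hg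
  exact S.word_apply_eq_of_mem_alcove l hx hgx

/-- Reflecting in a wall that has `x` on its negative side lowers the number of positive elements
that fail to be ≥ 0 at `x`. The hypotheses make this number finite and every failure of 0 ≤ an
actual ≤ 0. -/
theorem exists_apply_mem_alcove (x : X)
    (hcmp : ∀ q x', (∃ g ∈ Subgroup.closure (Set.range S.s), x' = g x) →
      0 ≤ S.eval (S.simple q) x' ∨ S.eval (S.simple q) x' ≤ 0)
    (hfin : {a | S.Pos a ∧ ¬ 0 ≤ S.eval a x}.Finite) :
    ∃ g ∈ Subgroup.closure (Set.range S.s), g x ∈ S.alcove := by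
  induction hn : {a | S.Pos a ∧ ¬ 0 ≤ S.eval a x}.ncard using Nat.strong_induction_on
    generalizing x with
  | _ n ih =>
    subst hn
    by_cases hx : x ∈ S.alcove
    · exact ⟨1, one_mem _, hx⟩
    obtain ⟨q, hq⟩ : ∃ q, ¬ 0 ≤ S.eval (S.simple q) x := by simpa [alcove] using hx
    have hq' : S.eval (S.simple q) x ≤ 0 := (hcmp q x ⟨1, one_mem _, rfl⟩).resolve_left hq
    -- `act q` permutes the positive elements other than `simple q`, and `simple q` itself is
    -- negative at `x` but no longer at `s q x`.
    have hsub : S.act q '' {a | S.Pos a ∧ ¬ 0 ≤ S.eval a (S.s q x)} ⊂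
        {a | S.Pos a ∧ ¬ 0 ≤ S.eval a x} := by
      rw [Set.ssubset_iff_of_subset]
      · refine ⟨S.simple q, ⟨S.pos_simple q, hq⟩, ?_⟩
        rintro ⟨a, ⟨ha, -⟩, hqa⟩
        have := S.act_act q a
        rw [hqa] at this
        rw [← this] at ha
        exact S.not_pos_act_simple q ha
      · rintro _ ⟨a, ⟨ha, hax⟩, rfl⟩
        refine ⟨S.pos_act q a ha ?_, by rwa [S.eval_act]⟩
        rintro rfl
        rw [s, S.eval_refl] at hax
        exact hax (neg_nonneg.mpr hq')
    have hinj : Function.Injective (S.act q) := Function.Involutive.injective (S.act_act q)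
    have hlt := Set.ncard_lt_ncard hsub hfin
    rw [Set.ncard_image_of_injective _ hinj] at hlt
    have hs : S.s q ∈ Subgroup.closure (Set.range S.s) := Subgroup.subset_closure ⟨q, rfl⟩
    obtain ⟨g, hg, hgx⟩ := ih _ hlt (S.s q x) (by
      rintro q' _ ⟨g, hg, rfl⟩
      exact hcmp q' _ ⟨g * S.s q, mul_mem hg hs, rfl⟩)
      ((hfin.subset hsub.subset).of_finite_image hinj.injOn) rfl
    exact ⟨g * S.s q, mul_mem hg hs, hgx⟩

end SimpleReflectionSystem

end

/-! ### Affine roots and affine reflections. -/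

noncomputable section

open scoped ComplexOrder

namespace RootPairing

section AffineRoots

variable {ι M N : Type*} [AddCommGroup M] [Module ℂ M] [AddCommGroup N] [Module ℂ N]
  (P : RootPairing ι ℂ M N)

/-- The value at `h` of the affine function `m + k` with linear part `m` and constant term `k`. -/
def affineEval (h : N) : M × ℤ →+ ℂ :=
  (P.toLinearMap.flip h).toAddMonoidHom.comp (AddMonoidHom.fst M ℤ) +
    (Int.castAddHom ℂ).comp (AddMonoidHom.snd M ℤ)

/-- The affine root `α + k`, for `α` of index `a.1` and `k = a.2`. -/
def affineRoot (a : ι × ℤ) : M × ℤ := (P.root a.1, a.2)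

theorem affineEval_affineRoot (h : N) (a : ι × ℤ) :
    P.affineEval h (P.affineRoot a) = P.root' a.1 h + a.2 := rfl

/-- The affine reflection attached to an affine root. -/
def affineReflection (a : ι × ℤ) : Equiv.Perm N :=
  Function.Involutive.toPerm
    (fun h => h - P.affineEval h (P.affineRoot a) • P.coroot a.1) <| by
    intro h
    simp only [affineEval_affineRoot, map_sub, map_smul, root'_coroot_eq_pairing, pairing_same,
      smul_eq_mul]
    module

theorem affineReflection_apply (a : ι × ℤ) (h : N) :
    P.affineReflection a h = h - (P.root' a.1 h + a.2) • P.coroot a.1 := rfl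

theorem affineReflection_mul_self (a : ι × ℤ) :
    P.affineReflection a * P.affineReflection a = 1 := by
  ext h
  exact (P.affineReflection a).left_inv h

variable [P.IsCrystallographic]

/-- The action on the affine roots of the affine reflection attached to an affine root. -/
def affineAct (a c : ι × ℤ) : ι × ℤ :=
  (P.reflectionPerm a.1 c.1, c.2 - a.2 * P.pairingIn ℤ c.1 a.1)

/-- This dictates the shift in `affineAct`: composing α + k with the reflection h ↦ h − (β(h) +
l)β^∨ gives s_β(α) + k − l⟨α, β^∨⟩. -/
theorem affineEval_affineAct (a c : ι × ℤ) (h : N) :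
    P.affineEval h (P.affineRoot (P.affineAct a c)) =
      P.affineEval (P.affineReflection a h) (P.affineRoot c) := by
  have h1 := P.algebraMap_pairingIn ℤ c.1 a.1
  simp only [eq_intCast] at h1
  simp only [affineEval_affineRoot, affineAct, affineReflection_apply, map_sub, map_smul,
    root'_coroot_eq_pairing, smul_eq_mul, Int.cast_sub, Int.cast_mul, h1]
  rw [root', root_reflectionPerm, reflection_apply, map_sub, map_smul]
  simp [root', root_coroot_eq_pairing]
  ring

theorem affineReflection_affineAct (a c : ι × ℤ) :
    P.affineReflection (P.affineAct a c) =
      P.affineReflection a * P.affineReflection c * P.affineReflection a := by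
  ext h
  have h1 := P.affineEval_affineAct a c h
  have h2 : P.affineReflection (P.affineAct a c) h = h - P.affineEval (P.affineReflection a h)
      (P.affineRoot c) • (P.coroot c.1 - P.pairing a.1 c.1 • P.coroot a.1) := by
    rw [← h1]
    change h - _ • P.coroot (P.reflectionPerm a.1 c.1) = _
    rw [coroot_reflectionPerm, coreflection_apply, root_coroot_eq_pairing]
  have h3 : P.affineReflection a (P.affineReflection a h) = h := (P.affineReflection a).left_inv h
  rw [h2, Equiv.Perm.mul_apply, Equiv.Perm.mul_apply]
  generalize P.affineReflection a h = x at h3 ⊢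
  rw [← h3]
  simp only [affineReflection_apply, affineEval_affineRoot, map_sub, map_smul,
    root'_coroot_eq_pairing, smul_eq_mul]
  module

theorem affineAct_affineAct (a c : ι × ℤ) : P.affineAct a (P.affineAct a c) = c := by
  ext
  · simp [affineAct]
  · simp [affineAct, ← pairingIn_reflectionPerm]

end AffineRoots

/-! ### Positive affine roots and the walls of the fundamental alcove. -/

section Alcove

variable {ι M N : Type*} [Finite ι] [AddCommGroup M] [Module ℂ M] [AddCommGroup N] [Module ℂ N]
  {P : RootPairing ι ℂ M N} [P.IsCrystallographic]

-- Lets heights replace the root order: with m the height of α_0, all heights lie in [m, −m], and m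
-- is attained by α_0 only.
omit [Finite ι] [P.IsCrystallographic] in
theorem Base.height_le_of_sub_mem (b : P.Base) {i j : ι}
    (h : P.root i - P.root j ∈ AddSubmonoid.closure (P.root '' b.support)) :
    b.height j ≤ b.height i ∧ (b.height j = b.height i → i = j) := by
  obtain ⟨f, -, -, hf⟩ := b.exists_root_eq_sum_int j
  obtain ⟨c, hc⟩ : ∃ c : ι → ℕ, P.root i - P.root j = ∑ k ∈ b.support, c k • P.root k := by
    rw [← Submodule.span_nat_eq_addSubmonoidClosure, Submodule.mem_toAddSubmonoid,
      Submodule.mem_span_image_finset_iff_exists_fun'] at h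
    obtain ⟨c, hc⟩ := h
    exact ⟨c, hc.symm⟩
  have hi : P.root i = ∑ k ∈ b.support, (f k + (c k : ℤ)) • P.root k := by
    simp_rw [add_smul, Finset.sum_add_distrib, ← hf, natCast_zsmul, ← hc]
    abel
  have h1 := Base.height_eq_sum (f := fun k => f k + (c k : ℤ)) hi
  have h2 := Base.height_eq_sum hf
  rw [Finset.sum_add_distrib, ← h2] at h1
  have h3 : 0 ≤ ∑ k ∈ b.support, (c k : ℤ) := Finset.sum_nonneg fun _ _ => by positivity
  refine ⟨by lia, fun h4 => ?_⟩
  have h5 : ∑ k ∈ b.support, (c k : ℤ) = 0 := by lia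
  rw [Finset.sum_eq_zero_iff_of_nonneg fun _ _ => by positivity] at h5
  refine P.root.injective (sub_eq_zero.mp ?_)
  rw [hc]
  exact Finset.sum_eq_zero fun k hk => by
    have : c k = 0 := by exact_mod_cast h5 k hk
    simp [this]

variable [P.IsRootSystem] [P.IsReduced] [P.IsIrreducible]

theorem Base.height_lowestRoot_le (b : P.Base) (i : ι) :
    b.height b.lowestRoot ≤ b.height i :=
  (b.height_le_of_sub_mem (b.sub_lowestRoot_mem i)).1

theorem Base.eq_lowestRoot_of_height_eq (b : P.Base) {i : ι}
    (h : b.height i = b.height b.lowestRoot) : i = b.lowestRoot :=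
  (b.height_le_of_sub_mem (b.sub_lowestRoot_mem i)).2 h.symm

theorem Base.height_le_neg_height_lowestRoot (b : P.Base) (i : ι) :
    b.height i ≤ -b.height b.lowestRoot := by
  have h1 := b.height_lowestRoot_le (P.reflectionPerm i i)
  have h2 : b.height (P.reflectionPerm i i) = -b.height i := b.height_reflectionPerm_self i
  lia

theorem Base.height_lowestRoot_neg (b : P.Base) : b.height b.lowestRoot < 0 := by
  have h1 := b.height_le_neg_height_lowestRoot b.lowestRoot
  have h2 := b.height_ne_zero b.lowestRoot
  lia

omit [Finite ι] [P.IsRootSystem] [P.IsReduced] [P.IsIrreducible] in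
theorem Base.height_reflectionPerm (b : P.Base) (i j : ι) :
    b.height (P.reflectionPerm j i) = b.height i - P.pairingIn ℤ i j * b.height j := by
  have : P.root (P.reflectionPerm j i) = P.root i + (-P.pairingIn ℤ i j) • P.root j := by
    rw [root_reflectionPerm, neg_smul, reflection_apply_root' ℤ, sub_eq_add_neg]
  rw [b.height_add_zsmul this, smul_eq_mul]
  ring

/-- The affine root attached to a vertex of the affine Dynkin diagram. -/
def Base.affineSimple (b : P.Base) : b.AffineVertex → ι × ℤ
  | none => (b.lowestRoot, 1)
  | some j => (j, 0)

theorem Base.affineSimple_fst (b : P.Base) (q : b.AffineVertex) :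
    (b.affineSimple q).1 = b.affineSimpleRoot q := by
  cases q <;> rfl

/-- The positive affine roots. -/
def Base.IsAffinePos (b : P.Base) (a : ι × ℤ) : Prop := 0 < a.2 ∨ a.2 = 0 ∧ b.IsPos a.1

theorem Base.isAffinePos_affineSimple (b : P.Base) (q : b.AffineVertex) :
    b.IsAffinePos (b.affineSimple q) := by
  cases q with
  | none => left; exact one_pos
  | some j => right; exact ⟨rfl, Base.isPos_of_mem_support j.2⟩

omit [Finite ι] [P.IsCrystallographic] [P.IsRootSystem] [P.IsReduced] [P.IsIrreducible] in
theorem Base.isAffinePos_or_neg (b : P.Base) (a : ι × ℤ) :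
    b.IsAffinePos a ∨ b.IsAffinePos (P.reflectionPerm a.1 a.1, -a.2) := by
  have h1 : b.height (P.reflectionPerm a.1 a.1) = -b.height a.1 := b.height_reflectionPerm_self a.1
  have h2 := b.height_ne_zero a.1
  simp only [IsAffinePos, isPos_iff]
  lia

theorem Base.not_isAffinePos_affineAct_self (b : P.Base) (q : b.AffineVertex) :
    ¬ b.IsAffinePos (P.affineAct (b.affineSimple q) (b.affineSimple q)) := by
  cases q with
  | none => simp [affineAct, IsAffinePos, affineSimple]
  | some j =>
    have h1 := Base.isPos_of_mem_support j.2
    have h2 : b.height (P.reflectionPerm j j) = -b.height j := b.height_reflectionPerm_self _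
    simp only [isPos_iff] at h1
    simp only [IsAffinePos, affineAct, affineSimple, isPos_iff]
    lia

theorem Base.isAffinePos_affineAct (b : P.Base) (q : b.AffineVertex) (a : ι × ℤ)
    (ha : b.IsAffinePos a) (hq : a ≠ b.affineSimple q) :
    b.IsAffinePos (P.affineAct (b.affineSimple q) a) := by
  obtain ⟨i, k⟩ := a
  cases q with
  | some j =>
    rcases ha with ha | ⟨rfl : k = 0, ha⟩
    · left
      simpa [affineAct, affineSimple] using ha
    · right
      refine ⟨by simp [affineAct, affineSimple], ?_⟩
      refine ha.reflectionPerm j.2 ?_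
      rintro rfl
      exact hq rfl
  | none =>
    have h1 := b.height_reflectionPerm i b.lowestRoot
    have h2 := b.height_le_neg_height_lowestRoot (P.reflectionPerm b.lowestRoot i)
    have h3 := b.height_lowestRoot_le i
    have h4 := b.height_lowestRoot_neg
    have h5 : b.height i = b.height b.lowestRoot → k ≠ 1 := by
      rintro h rfl
      rw [b.eq_lowestRoot_of_height_eq h] at hq
      exact hq rfl
    have h6 : P.pairingIn ℤ i b.lowestRoot = 0 → b.height (P.reflectionPerm b.lowestRoot i) =
      b.height i := fun h => by rw [h1, h]; ring
    have h7 := b.height_ne_zero (P.reflectionPerm b.lowestRoot i)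
    simp only [IsAffinePos, isPos_iff] at ha
    simp only [IsAffinePos, affineAct, affineSimple, isPos_iff, one_mul]
    generalize P.pairingIn ℤ i b.lowestRoot = p at *
    generalize b.height (P.reflectionPerm b.lowestRoot i) = H' at *
    generalize b.height i = H at *
    generalize b.height b.lowestRoot = m at *
    -- The image has constant term k − p and height H' = H − pm ≤ −m, with m < 0. For p = 1 this
    -- excludes k = 0, and k = 1 gives H' > 0. For p = 2 it forces H = m, so the root is α_0 and k ≥
    -- 2 because α_0 + 1 is excluded. For p ≥ 3 it contradicts H ≥ m.
    rcases lt_trichotomy p 0 with hp | rfl | hp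
    · left; lia
    · lia
    · obtain rfl | rfl | hp3 : p = 1 ∨ p = 2 ∨ 3 ≤ p := by lia
      · lia
      · lia
      · nlinarith

/-- If the pairing p has |p| ≥ 2, then H and H − pm can both lie in [m, −m] only for H = ±m, that
is, for the roots ±α_0. -/
theorem Base.pairingIn_lowestRoot (b : P.Base) (i : ι)
    (h : P.pairingIn ℤ i b.lowestRoot ≠ 0) :
    P.root i = P.root b.lowestRoot ∨ P.root i = -P.root b.lowestRoot ∨
      P.pairingIn ℤ i b.lowestRoot = 1 ∨ P.pairingIn ℤ i b.lowestRoot = -1 := by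
  have h1 := b.height_reflectionPerm i b.lowestRoot
  have h2 := b.height_le_neg_height_lowestRoot (P.reflectionPerm b.lowestRoot i)
  have h2' := b.height_lowestRoot_le (P.reflectionPerm b.lowestRoot i)
  have h3 := b.height_lowestRoot_le i
  have h3' := b.height_le_neg_height_lowestRoot i
  have h4 := b.height_lowestRoot_neg
  have h5 : b.height i = b.height b.lowestRoot → P.root i = P.root b.lowestRoot := fun h => by
    rw [b.eq_lowestRoot_of_height_eq h]
  have h6 : b.height i = -b.height b.lowestRoot → P.root i = -P.root b.lowestRoot := fun h => by
    rw [← b.eq_lowestRoot_of_height_eq (i := P.reflectionPerm i i)]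
    · simp
    · have : b.height (P.reflectionPerm i i) = -b.height i := b.height_reflectionPerm_self i
      lia
  generalize P.pairingIn ℤ i b.lowestRoot = p at *
  rw [h1] at h2 h2'
  rcases lt_trichotomy p 0 with hp | rfl | hp
  · obtain rfl | hp : p = -1 ∨ p ≤ -2 := by lia
    · simp
    · exact .inr (.inl (h6 (by nlinarith)))
  · exact absurd rfl h
  · obtain rfl | hp : p = 1 ∨ 2 ≤ p := by lia
    · simp
    · exact .inl (h5 (by nlinarith))

theorem Base.affineRoot_mem_closure (b : P.Base) {a : ι × ℤ} (ha : b.IsAffinePos a) :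
    P.affineRoot a ∈ AddSubmonoid.closure (Set.range (P.affineRoot ∘ b.affineSimple)) := by
  set C := AddSubmonoid.closure (Set.range (P.affineRoot ∘ b.affineSimple)) with hC
  have hmem : ∀ m ∈ AddSubmonoid.closure (P.root '' b.support), ((m, 0) : M × ℤ) ∈ C := by
    intro m hm
    have h1 : AddSubmonoid.closure (P.root '' b.support) ≤
        C.comap (AddMonoidHom.inl M ℤ) := by
      rw [AddSubmonoid.closure_le]
      rintro _ ⟨j, hj, rfl⟩
      exact AddSubmonoid.subset_closure ⟨some ⟨j, hj⟩, rfl⟩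
    exact h1 hm
  have h0 : ((P.root b.lowestRoot, 1) : M × ℤ) ∈ C := AddSubmonoid.subset_closure ⟨none, rfl⟩
  -- The constant 1 is (−α_0) + (α_0 + 1), and −α_0 is a positive root.
  have h1 : ((0, 1) : M × ℤ) ∈ C := by
    have h2 : b.IsPos (P.reflectionPerm b.lowestRoot b.lowestRoot) := by
      have h3 : b.height (P.reflectionPerm b.lowestRoot b.lowestRoot) = -b.height b.lowestRoot :=
        b.height_reflectionPerm_self _
      have := b.height_lowestRoot_neg
      rw [isPos_iff]
      lia
    have h3 := add_mem (hmem _ (b.mem_closure_of_isPos h2)) h0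
    simpa using h3
  obtain ⟨i, k⟩ := a
  rcases ha with ha | ⟨rfl : k = 0, ha⟩
  · have h2 := add_mem (add_mem (hmem _ (b.sub_lowestRoot_mem i)) h0) (nsmul_mem h1 (k - 1).toNat)
    have h3 : P.affineRoot (i, k) = (P.root i - P.root b.lowestRoot, 0) +
        (P.root b.lowestRoot, 1) + (k - 1).toNat • ((0, 1) : M × ℤ) := by
      simp only at ha
      ext
      · simp [affineRoot]
      · simp [affineRoot]; lia
    rwa [h3]
  · exact hmem _ (b.mem_closure_of_isPos ha)

/-- A sum of non-negative values vanishes only if every summand does, so only walls through `x` can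
occur in a combination that vanishes at `x`. -/
theorem Base.affineEval_nonneg_and_mem_closure (b : P.Base) {x : N}
    (hx : ∀ q, 0 ≤ P.affineEval x (P.affineRoot (b.affineSimple q)))
    {u : M × ℤ} (hu : u ∈ AddSubmonoid.closure (Set.range (P.affineRoot ∘ b.affineSimple))) :
    0 ≤ P.affineEval x u ∧ (P.affineEval x u = 0 → u ∈ AddSubmonoid.closure
      (P.affineRoot ∘ b.affineSimple ''
        {q | P.affineEval x (P.affineRoot (b.affineSimple q)) = 0})) := by
  induction hu using AddSubmonoid.closure_induction with
  | mem u hu =>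
    obtain ⟨q, rfl⟩ := hu
    exact ⟨hx q, fun h => AddSubmonoid.subset_closure ⟨q, h, rfl⟩⟩
  | zero => simp [zero_mem]
  | add u v _ _ hu hv =>
    refine ⟨by rw [map_add]; exact add_nonneg hu.1 hv.1, fun h => ?_⟩
    rw [map_add, add_eq_zero_iff_of_nonneg hu.1 hv.1] at h
    exact add_mem (hu.2 h.1) (hv.2 h.2)

/-- The affine reflections in the walls of the fundamental alcove. -/
def Base.alcoveSystem (b : P.Base) : SimpleReflectionSystem b.AffineVertex (ι × ℤ) N where
  eval a h := P.affineEval h (P.affineRoot a)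
  refl := P.affineReflection
  simple := b.affineSimple
  act q := P.affineAct (b.affineSimple q)
  Pos := b.IsAffinePos
  eval_act q a x := P.affineEval_affineAct _ a x
  refl_act q a := P.affineReflection_affineAct _ a
  act_act q a := P.affineAct_affineAct _ a
  refl_mul_self q := P.affineReflection_mul_self _
  eval_refl q x := by
    simp only [affineReflection_apply, affineEval_affineRoot, map_sub, map_smul,
      root'_coroot_eq_pairing, smul_eq_mul, pairing_same]
    ring
  refl_eq_self q x h := by
    rw [affineEval_affineRoot] at h
    rw [affineReflection_apply, h, zero_smul, sub_zero]
  pos_simple := b.isAffinePos_affineSimple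
  not_pos_act_simple := b.not_isAffinePos_affineAct_self
  pos_act := b.isAffinePos_affineAct
  eval_nonneg a x ha hx := (b.affineEval_nonneg_and_mem_closure hx (b.affineRoot_mem_closure ha)).1

end Alcove

end RootPairing

end

/-! ### The affine Weyl group: translations and linear parts. -/

noncomputable section

open scoped ComplexOrder

namespace RootPairing

section AffineWeylGroup

variable {ι M N : Type*} [AddCommGroup M] [Module ℂ M] [AddCommGroup N] [Module ℂ N]

theorem coweightAct_ofIdx (P : RootPairing ι ℂ M N) (i : ι) (h : N) :
    P.coweightAct (weylGroup.ofIdx P i) h = h - P.root' i h • P.coroot i := by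
  have h1 : ((weylGroup.ofIdx P i)⁻¹ : P.weylGroup).1 = Equiv.reflection P i :=
    Equiv.reflection_inv P i
  rw [coweightAct, h1, Equiv.reflection_coweightEquiv, coreflection_apply]

theorem eq_of_coweightAct_eq (P : RootPairing ι ℂ M N) {v w : P.weylGroup}
    (h : ∀ x, P.coweightAct v x = P.coweightAct w x) : v = w := by
  have h1 : Equiv.coweightHom P (v⁻¹ : P.weylGroup).1 = Equiv.coweightHom P (w⁻¹ : P.weylGroup).1 :=
    congrArg MulOpposite.op (LinearEquiv.ext h)
  exact inv_injective (Subtype.ext (Equiv.coweightHom_injective P h1))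

theorem weylGroupToPerm_injective (P : RootPairing ι ℂ M N) [P.IsRootSystem] :
    Function.Injective P.weylGroupToPerm := by
  refine fun v w h => P.eq_of_coweightAct_eq fun x => ?_
  have h1 : (P.coweightAct v).toLinearMap = (P.coweightAct w).toLinearMap := by
    refine LinearMap.ext_on_range (v := P.coroot) IsRootSystem.span_coroot_eq_top fun i => ?_
    simp only [LinearEquiv.coe_coe, coweightAct_coroot, h]
  exact LinearMap.congr_fun h1 x

theorem finite_weylGroup [Finite ι] (P : RootPairing ι ℂ M N) [P.IsRootSystem] :
    Finite P.weylGroup :=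
  Finite.of_injective _ P.weylGroupToPerm_injective

variable [Finite ι] {P : RootPairing ι ℂ M N} [P.IsCrystallographic] [P.IsRootSystem]
  [P.IsReduced] [P.IsIrreducible]

/-- The group generated by the affine reflections in the walls of the fundamental alcove. -/
def Base.affineWeylGroup (b : P.Base) : Subgroup (Equiv.Perm N) :=
  Subgroup.closure (Set.range b.alcoveSystem.s)

theorem Base.affineReflection_mem (b : P.Base) (i : ι) :
    P.affineReflection (i, 0) ∈ b.affineWeylGroup := by
  refine b.induction_reflect i (p := fun i => P.affineReflection (i, 0) ∈ b.affineWeylGroup)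
    (fun i hi => ?_) (fun i hi => Subgroup.subset_closure ⟨some ⟨i, hi⟩, rfl⟩)
    (fun i j hi hj => ?_)
  · have h1 : P.affineReflection (P.reflectionPerm i i, 0) = P.affineReflection (i, 0) := by
      ext h
      simp [affineReflection_apply, root']
    rwa [h1]
  · have h1 : P.affineReflection (P.reflectionPerm j i, 0) ∈ b.affineWeylGroup := by
      have h2 := P.affineReflection_affineAct (j, 0) (i, 0)
      have h3 : P.affineAct (j, 0) (i, 0) = (P.reflectionPerm j i, 0) := by simp [affineAct]
      have h4 : P.affineReflection (j, 0) ∈ b.affineWeylGroup :=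
        Subgroup.subset_closure ⟨some ⟨j, hj⟩, rfl⟩
      rw [h3] at h2
      rw [h2]
      exact mul_mem (mul_mem h4 hi) h4
    exact h1

theorem Base.coweightAct_mem (b : P.Base) (w : P.weylGroup) :
    (P.coweightAct w).toEquiv ∈ b.affineWeylGroup := by
  obtain ⟨w, hw⟩ := w
  induction hw using weylGroup.induction with
  | mem i =>
    convert b.affineReflection_mem i using 1
    ext h
    have := P.coweightAct_ofIdx i h
    simpa [affineReflection_apply, weylGroup.ofIdx] using this
  | one =>
    convert one_mem b.affineWeylGroup using 1
    ext h
    exact LinearEquiv.congr_fun P.coweightAct_one h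
  | mul x y hx hy ihx ihy =>
    convert mul_mem ihx ihy using 1
    ext h
    exact LinearEquiv.congr_fun (P.coweightAct_mul ⟨x, hx⟩ ⟨y, hy⟩) h

/-- The translations in the affine Weyl group. -/
def Base.translations (b : P.Base) : AddSubgroup N where
  carrier := {l | Equiv.addRight l ∈ b.affineWeylGroup}
  add_mem' {l m} hl hm := by
    have : Equiv.addRight (l + m) = Equiv.addRight m * Equiv.addRight l := by
      ext h; simp [add_assoc]
    simpa only [Set.mem_ofPred_eq, this] using mul_mem hm hl
  zero_mem' := by
    have : Equiv.addRight (0 : N) = 1 := by ext h; simp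
    simpa only [Set.mem_ofPred_eq, this] using one_mem _
  neg_mem' {l} hl := by
    have : Equiv.addRight (-l) = (Equiv.addRight l)⁻¹ := by ext h; simp
    simpa only [Set.mem_ofPred_eq, this] using inv_mem hl

theorem Base.coweightAct_mem_translations (b : P.Base) (w : P.weylGroup) {l : N}
    (hl : l ∈ b.translations) : P.coweightAct w l ∈ b.translations := by
  have h1 : Equiv.addRight (P.coweightAct w l) = (P.coweightAct w).toEquiv * Equiv.addRight l *
      ((P.coweightAct w).toEquiv)⁻¹ := by
    ext h
    have : P.coweightAct w ((P.coweightAct w).symm h) = h := LinearEquiv.apply_symm_apply _ _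
    change h + P.coweightAct w l = P.coweightAct w ((P.coweightAct w).symm h + l)
    rw [map_add, this]
  change Equiv.addRight _ ∈ b.affineWeylGroup
  rw [h1]
  exact mul_mem (mul_mem (b.coweightAct_mem w) hl) (inv_mem (b.coweightAct_mem w))

/-- The product s_{α_0+1} s_{α_0} is the translation by −α_0^∨. Its W-conjugates need not reach
coroots of another length; differences α_0^∨ − s_α(α_0^∨) = ⟨α, α_0^∨⟩α^∨ do, since this coefficient
is ±1 whenever it is nonzero and α ≠ ±α_0. -/
theorem Base.coroot_mem_translations (b : P.Base) (i : ι) : P.coroot i ∈ b.translations := by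
  have h0 : P.coroot b.lowestRoot ∈ b.translations := by
    rw [← neg_mem_iff]
    have h1 : P.affineReflection (b.lowestRoot, 1) ∈ b.affineWeylGroup :=
      Subgroup.subset_closure ⟨none, rfl⟩
    have h2 : Equiv.addRight (-P.coroot b.lowestRoot) =
        P.affineReflection (b.lowestRoot, 1) * P.affineReflection (b.lowestRoot, 0) := by
      ext h
      simp only [Equiv.coe_addRight, Equiv.Perm.mul_apply, affineReflection_apply, map_sub,
        map_smul, root'_coroot_eq_pairing, pairing_same, smul_eq_mul, Int.cast_zero, Int.cast_one]
      module
    change Equiv.addRight _ ∈ b.affineWeylGroup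
    rw [h2]
    exact mul_mem h1 (b.affineReflection_mem _)
  have key : ∀ j, P.pairing j b.lowestRoot ≠ 0 → P.coroot j ∈ b.translations := by
    intro j hj
    have h1 := P.algebraMap_pairingIn ℤ j b.lowestRoot
    simp only [eq_intCast] at h1
    have h2 : P.pairingIn ℤ j b.lowestRoot ≠ 0 := by
      intro h
      rw [h] at h1
      exact hj (by simpa using h1.symm)
    have h3 : P.coroot b.lowestRoot - P.coweightAct (weylGroup.ofIdx P j) (P.coroot b.lowestRoot) ∈
        b.translations := sub_mem h0 (b.coweightAct_mem_translations _ h0)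
    rw [coweightAct_ofIdx, sub_sub_cancel, root'_coroot_eq_pairing, ← h1] at h3
    rcases b.pairingIn_lowestRoot j h2 with h | h | h | h
    · rwa [P.root.injective h]
    · have h4 : j = P.reflectionPerm b.lowestRoot b.lowestRoot := P.root.injective (by simpa using h)
      rw [h4, coroot_reflectionPerm, coreflection_apply_self]
      exact neg_mem h0
    · simpa [h] using h3
    · simpa [h] using h3
  -- Otherwise the W-orbit of the root, which spans 𝔥* by irreducibility, would lie in the kernel of
  -- α_0^∨.
  obtain ⟨w, hw⟩ : ∃ w : P.weylGroup, P.pairing (P.weylGroupToPerm w i) b.lowestRoot ≠ 0 := by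
    by_contra! hw
    have h1 : Submodule.span ℂ (MulAction.orbit P.weylGroup (P.root i)) ≤
        LinearMap.ker (P.coroot' b.lowestRoot) := by
      rw [Submodule.span_le]
      rintro _ ⟨w, rfl⟩
      change P.coroot' b.lowestRoot (w • P.root i) = 0
      rw [weylGroup_apply_root]
      exact hw w
    rw [span_orbit_eq_top] at h1
    have h2 : P.root b.lowestRoot ∈ LinearMap.ker (P.coroot' b.lowestRoot) := h1 trivial
    simp at h2
  have h1 := b.coweightAct_mem_translations w⁻¹ (key _ hw)
  rw [coweightAct_coroot] at h1
  simpa using h1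

/-- The group generated by the affine reflections in the walls of the fundamental alcove contains
the semidirect product of the Weyl group and the coroot lattice. -/
theorem Base.mem_affineWeylGroup_of_eq (b : P.Base) {g : Equiv.Perm N} (w : P.weylGroup) {l : N}
    (hl : l ∈ P.corootLattice) (hg : ∀ h, g h = P.coweightAct w h + l) :
    g ∈ b.affineWeylGroup := by
  have h1 : P.corootLattice ≤ b.translations := by
    rw [corootLattice, AddSubgroup.closure_le]
    rintro _ ⟨i, rfl⟩
    exact b.coroot_mem_translations i
  have h2 : g = Equiv.addRight l * (P.coweightAct w).toEquiv := by
    ext h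
    rw [hg]; rfl
  rw [h2]
  exact mul_mem (h1 hl) (b.coweightAct_mem w)

/-- The linear part of an element of a group generated by affine reflections. -/
theorem Base.exists_linear_part (b : P.Base) (s : Set b.AffineVertex) {g : Equiv.Perm N}
    (hg : g ∈ Subgroup.closure (b.alcoveSystem.s '' s)) :
    ∃ w ∈ Subgroup.closure ((fun q => weylGroup.ofIdx P (b.affineSimpleRoot q)) '' s),
      ∃ l ∈ P.corootLattice, ∀ h, g h = P.coweightAct w h + l := by
  induction hg using Subgroup.closure_induction with
  | mem g hg =>
    obtain ⟨q, hq, rfl⟩ := hg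
    refine ⟨_, Subgroup.subset_closure ⟨q, hq, rfl⟩,
      -(b.affineSimple q).2 • P.coroot (b.affineSimple q).1,
      zsmul_mem (AddSubgroup.subset_closure (Set.mem_range_self _)) _, fun h => ?_⟩
    change P.affineReflection (b.affineSimple q) h = _
    rw [affineReflection_apply, coweightAct_ofIdx, ← b.affineSimple_fst, ← Int.cast_smul_eq_zsmul ℂ]
    push_cast
    module
  | one => exact ⟨1, one_mem _, 0, zero_mem _, fun h => by simp [coweightAct_one]⟩
  | mul g g' _ _ hg hg' =>
    obtain ⟨w, hw, l, hl, hg⟩ := hg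
    obtain ⟨w', hw', l', hl', hg'⟩ := hg'
    refine ⟨w * w', mul_mem hw hw', P.coweightAct w l' + l,
      add_mem (P.corootLattice_le_comap w hl') hl, fun h => ?_⟩
    rw [Equiv.Perm.mul_apply, hg, hg', coweightAct_mul, map_add, add_assoc]
    rfl
  | inv g _ hg =>
    obtain ⟨w, hw, l, hl, hg⟩ := hg
    refine ⟨w⁻¹, inv_mem hw, P.coweightAct w⁻¹ (-l),
      P.corootLattice_le_comap w⁻¹ (neg_mem hl), fun h => ?_⟩
    have h1 : ∀ x, P.coweightAct w (P.coweightAct w⁻¹ x) = x := fun x => by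
      have := LinearEquiv.congr_fun (P.coweightAct_mul w w⁻¹) x
      rw [mul_inv_cancel, coweightAct_one] at this
      exact this.symm
    rw [Equiv.Perm.inv_eq_iff_eq, hg, map_add, h1, h1, neg_add_cancel_right]

end AffineWeylGroup

end RootPairing

end

/-! ### Zero-dimensional layers as points where the integral roots separate. -/

noncomputable section

namespace RootPairing

section Layers

variable {ι M N : Type*} [AddCommGroup M] [Module ℂ M] [AddCommGroup N] [Module ℂ N]

/-- A set of roots separates the points of `𝔥` (equivalently, it spans `𝔥*`). -/
def Separates (P : RootPairing ι ℂ M N) (S : Set ι) : Prop :=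
  ∀ h : N, (∀ i ∈ S, P.root' i h = 0) → h = 0

theorem Separates.mono {P : RootPairing ι ℂ M N} {S T : Set ι} (hS : P.Separates S) (h : S ⊆ T) :
    P.Separates T :=
  fun x hx => hS x fun i hi => hx i (h hi)

theorem mem_rootsAt_mk_iff {P : RootPairing ι ℂ M N} [P.IsCrystallographic] {i : ι} {h : N} :
    i ∈ P.rootsAt (h : P.Torus) ↔ ∃ n : ℤ, P.root' i h = n := by
  change (QuotientAddGroup.mk (P.root' i h) : ℂ ⧸ AddSubgroup.zmultiples (1 : ℂ)) = 0 ↔ _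
  rw [QuotientAddGroup.eq_zero_iff, AddSubgroup.mem_zmultiples_iff]
  simp [eq_comm]

theorem exists_int_eq_of_mem_corootLattice (P : RootPairing ι ℂ M N) [P.IsCrystallographic]
    (i : ι) {l : N} (hl : l ∈ P.corootLattice) : ∃ n : ℤ, P.root' i l = n := by
  obtain ⟨n, hn⟩ := AddSubgroup.mem_zmultiples_iff.mp (P.corootLattice_le_comap_root' i hl)
  exact ⟨n, by simpa using hn.symm⟩

theorem separates_univ (P : RootPairing ι ℂ M N) [P.IsRootSystem] : P.Separates Set.univ :=
  fun _ hx => (P.flip.eq_zero_iff_forall_coroot'_eq_zero).mpr fun i => hx i trivial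

theorem Base.separates_support {P : RootPairing ι ℂ M N} [P.IsRootSystem] (b : P.Base) :
    P.Separates b.support := by
  refine fun x hx => P.separates_univ x fun i _ => ?_
  have h1 : Submodule.span ℂ (P.root '' b.support) ≤ LinearMap.ker (P.toLinearMap.flip x) := by
    rw [Submodule.span_le]
    rintro _ ⟨j, hj, rfl⟩
    exact hx j hj
  rw [b.span_root_support] at h1
  exact h1 (Submodule.subset_span ⟨i, rfl⟩)

theorem Base.sum_repr_coroot {P : RootPairing ι ℂ M N} [P.IsRootSystem] (b : P.Base) (h : N) :
    ∑ j, b.toCoweightBasis.repr h j • P.coroot j = h := by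
  simpa using b.toCoweightBasis.sum_repr h

/-- If a separating set of roots takes integral values at a point, then all roots take real
values there. -/
theorem im_root'_eq_zero {P : RootPairing ι ℂ M N} [P.IsRootSystem] [P.IsCrystallographic]
    (b : P.Base) {h : N} (hs : P.Separates (P.rootsAt (h : P.Torus))) (i : ι) :
    (P.root' i h).im = 0 := by
  -- The imaginary part of `h` in simple coroot coordinates. Pairings are integers, so each root
  -- takes at `h'` the imaginary part of its value at `h`; the separating roots therefore kill `h'`.
  set h' : N := ∑ j, ((b.toCoweightBasis.repr h j).im : ℂ) • P.coroot j with hh'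
  have key : ∀ i, P.root' i h' = (P.root' i h).im := by
    intro i
    conv_rhs => rw [← b.sum_repr_coroot h]
    rw [hh', map_sum, map_sum, Complex.im_sum, Complex.ofReal_sum]
    refine Finset.sum_congr rfl fun j _ => ?_
    have h1 := P.algebraMap_pairingIn ℤ i j
    simp only [eq_intCast] at h1
    simp only [map_smul, root'_coroot_eq_pairing, ← h1, smul_eq_mul, Complex.mul_im,
      Complex.intCast_re, Complex.intCast_im]
    simp
  have h0 : h' = 0 := hs h' fun j hj => by
    obtain ⟨n, hn⟩ := mem_rootsAt_mk_iff.mp hj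
    rw [key, hn, Complex.intCast_im, Complex.ofReal_zero]
  have h1 := key i
  rw [h0, map_zero] at h1
  exact_mod_cast h1.symm

/-- In this coordinate form the lattice is visibly closed, which makes the torus a T1 space. -/
theorem Base.mem_corootLattice_iff {P : RootPairing ι ℂ M N} [P.IsRootSystem] (b : P.Base)
    {h : N} : h ∈ P.corootLattice ↔
      ∀ j, b.toCoweightBasis.coord j h ∈ Set.range ((↑) : ℤ → ℂ) := by
  constructor
  · intro hh j
    have h1 : h ∈ Submodule.span ℤ (P.coroot '' b.support) := by
      rw [b.span_int_coroot_support, ← Submodule.mem_toAddSubgroup,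
        Submodule.span_int_eq_addSubgroupClosure]
      exact hh
    clear hh
    induction h1 using Submodule.span_induction with
    | mem x hx =>
      obtain ⟨i, hi, rfl⟩ := hx
      classical
      refine ⟨if (⟨i, hi⟩ : b.support) = j then 1 else 0, ?_⟩
      have := b.toCoweightBasis_repr_coroot ⟨i, hi⟩
      simp only at this
      rw [Module.Basis.coord_apply, this, Finsupp.single_apply]
      split_ifs <;> simp
    | zero => exact ⟨0, by simp⟩
    | add x y _ _ ihx ihy =>
      obtain ⟨m, hm⟩ := ihx
      obtain ⟨n, hn⟩ := ihy
      exact ⟨m + n, by rw [map_add, Int.cast_add, hm, hn]⟩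
    | smul n x _ ih =>
      obtain ⟨m, hm⟩ := ih
      exact ⟨n * m, by rw [map_zsmul, Int.cast_mul, hm, zsmul_eq_mul]⟩
  · intro hh
    rw [← b.sum_repr_coroot h]
    refine sum_mem fun j _ => ?_
    obtain ⟨n, hn⟩ := hh j
    rw [Module.Basis.coord_apply] at hn
    rw [← hn, Int.cast_smul_eq_zsmul]
    exact zsmul_mem (AddSubgroup.subset_closure (Set.mem_range_self _)) n

variable [Finite ι] [TopologicalSpace N] [IsTopologicalAddGroup N] [ContinuousSMul ℂ N] [T2Space N]

theorem Base.isClosed_corootLattice {P : RootPairing ι ℂ M N} [P.IsRootSystem] (b : P.Base) :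
    IsClosed (P.corootLattice : Set N) := by
  have hfin : FiniteDimensional ℂ N := b.toCoweightBasis.finiteDimensional_of_finite
  have h1 : (P.corootLattice : Set N) =
      ⋂ j, b.toCoweightBasis.coord j ⁻¹' Set.range ((↑) : ℤ → ℂ) := by
    ext h
    simpa using b.mem_corootLattice_iff
  rw [h1]
  refine isClosed_iInter fun j => IsClosed.preimage ?_ Complex.isClosed_range_intCast
  exact LinearMap.continuous_of_finiteDimensional _

-- If all roots of `S` kill x, the connected set t + ℂx stays in the intersection, so it collapses
-- to t and the whole line ℂx lies in the lattice. Integrality of the roots on the lattice then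
-- forces x = 0.
omit [Finite ι] [T2Space N] in
theorem separates_rootsAt_of_isLayer {P : RootPairing ι ℂ M N} [P.IsRootSystem]
    [P.IsCrystallographic] {t : P.Torus} (ht : P.IsLayer {t}) : P.Separates (P.rootsAt t) := by
  obtain ⟨S, s, hs, hC⟩ := ht
  have hst : t = s := by
    have := mem_connectedComponentIn hs
    rw [← hC] at this
    exact (Set.mem_singleton_iff.mp this).symm
  subst hst
  have hSt : S ⊆ P.rootsAt t := fun i hi => Set.mem_iInter₂.mp hs i hi
  refine Separates.mono (fun x hx => ?_) hSt
  let f : ℂ → P.Torus := fun r => t + ((r • x : N) : P.Torus)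
  have hf : Continuous f :=
    continuous_const.add (continuous_quot_mk.comp (continuous_id.smul continuous_const))
  have hfmem : Set.range f ⊆ ⋂ i ∈ S, P.hypersurface i := by
    rintro _ ⟨r, rfl⟩
    refine Set.mem_iInter₂.mpr fun i hi => ?_
    have h1 : P.rootChar i t = 0 := hSt hi
    have h2 : P.rootChar i ((r • x : N) : P.Torus) = 0 :=
      mem_rootsAt_mk_iff.mpr ⟨0, by rw [map_smul, hx i hi]; simp⟩
    change P.rootChar i (t + _) = 0
    rw [map_add, h1, h2, add_zero]
  have hsub := (isPreconnected_range hf).subset_connectedComponentIn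
    (x := t) ⟨0, by simp [f]⟩ hfmem
  rw [← hC] at hsub
  have hL : ∀ r : ℂ, r • x ∈ P.corootLattice := by
    intro r
    have h1 : f r = t := hsub ⟨r, rfl⟩
    have h2 : ((r • x : N) : P.Torus) = 0 := by simpa [f] using h1
    exact (QuotientAddGroup.eq_zero_iff _).mp h2
  refine P.separates_univ x fun i _ => ?_
  by_contra h0
  -- The scalar is chosen so that the root takes the value 1/2.
  obtain ⟨n, hn⟩ := P.exists_int_eq_of_mem_corootLattice i (hL (2 * P.root' i x)⁻¹)
  rw [map_smul, smul_eq_mul, mul_inv, mul_assoc, inv_mul_cancel₀ h0, mul_one] at hn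
  have h2 : (1 : ℂ) = ((2 * n : ℤ) : ℂ) := by push_cast; rw [← hn]; norm_num
  have h3 : (1 : ℤ) = 2 * n := by exact_mod_cast h2
  lia

/-- Provided that there are only finitely many of them, the points at which a separating set of
roots takes integral values are 0-dimensional layers. -/
theorem Base.isLayer_of_separates {P : RootPairing ι ℂ M N} [P.IsRootSystem]
    [P.IsCrystallographic] (b : P.Base) (hfin : {u : P.Torus | P.Separates (P.rootsAt u)}.Finite)
    {t : P.Torus} (ht : P.Separates (P.rootsAt t)) : P.IsLayer {t} := by
  have : IsClosed (P.corootLattice : Set N) := b.isClosed_corootLattice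
  have hT : T1Space P.Torus := inferInstance
  have hmem : t ∈ ⋂ i ∈ P.rootsAt t, P.hypersurface i := Set.mem_iInter₂.mpr fun i hi => hi
  refine ⟨P.rootsAt t, t, hmem, ?_⟩
  refine (Set.Subsingleton.eq_singleton_of_mem ?_ (mem_connectedComponentIn hmem)).symm
  rw [← Set.not_nontrivial_iff]
  intro hn
  -- In a T1 space a preconnected set with two points is infinite, while every point of this
  -- component satisfies the separation condition.
  refine isPreconnected_connectedComponentIn.infinite_of_nontrivial hn (hfin.subset ?_)
  intro u hu
  exact ht.mono fun i hi => Set.mem_iInter₂.mp (connectedComponentIn_subset _ _ hu) i hi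

end Layers

end RootPairing

end

/-! ### Vertices of the alcove: their roots, stabilizers and orbits. -/

noncomputable section

open scoped ComplexOrder

namespace RootPairing

section Vertices

variable {ι M N : Type*} [Finite ι] [AddCommGroup M] [Module ℂ M] [AddCommGroup N] [Module ℂ N]
  {P : RootPairing ι ℂ M N} [P.IsCrystallographic]

omit [Finite ι] in
theorem isSubsystem_subsystemClosure (P : RootPairing ι ℂ M N) (S : Set ι) :
    P.IsSubsystem (P.subsystemClosure S) :=
  ⟨fun i hi j hj Θ hΘ => hΘ.1.1 i (hi Θ hΘ) j hj,
    fun i hi j hj k hk Θ hΘ => hΘ.1.2 i (hi Θ hΘ) j (hj Θ hΘ) k hk⟩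

omit [Finite ι] in
theorem subset_subsystemClosure (P : RootPairing ι ℂ M N) (S : Set ι) :
    S ⊆ P.subsystemClosure S :=
  fun _ hi _ hΘ => hΘ.2 hi

/-- A root that is a sum of elements of a set of roots lies in the subsystem it generates. -/
theorem mem_subsystemClosure_of_mem_closure {S : Set ι} {i : ι}
    (hi : P.root i ∈ AddSubmonoid.closure (P.root '' S)) : i ∈ P.subsystemClosure S := by
  obtain ⟨l, hl, hli⟩ := AddSubmonoid.exists_multiset_of_mem_closure hi
  induction hn : l.card generalizing l i with
  | zero =>
    rw [Multiset.card_eq_zero.mp hn, Multiset.sum_zero] at hli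
    exact absurd hli.symm (P.ne_zero i)
  | succ n ih =>
    -- The root pairs to 2 > 0 with its own coroot, so some summand pairs positively with it. Unless
    -- they are equal, their difference is a root and a sum with one term fewer.
    obtain ⟨m, hm, hpos⟩ : ∃ m ∈ l, 0 < (P.coroot' i m).re := by
      by_contra! h
      have h1 : (P.coroot' i (P.root i)).re ≤ 0 := by
        rw [← hli, map_multiset_sum]
        change Complex.reAddGroupHom (Multiset.sum _) ≤ 0
        rw [map_multiset_sum, Multiset.map_map]
        exact (Multiset.sum_le_card_nsmul _ 0 (by simpa using h)).trans_eq (smul_zero _)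
      simp at h1
      norm_num at h1
    obtain ⟨j, hj, rfl⟩ := hl m hm
    have hji : 0 < P.pairingIn ℤ j i := by
      have h1 := P.algebraMap_pairingIn ℤ j i
      rw [eq_intCast] at h1
      rw [root_coroot'_eq_pairing, ← h1, Complex.intCast_re] at hpos
      exact_mod_cast hpos
    by_cases hij : i = j
    · rw [hij]; exact P.subset_subsystemClosure S hj
    have hij' : 0 < P.pairingIn ℤ i j := by rwa [P.zero_lt_pairingIn_iff'] at hji
    obtain ⟨k, hk⟩ := P.root_sub_root_mem_of_pairingIn_pos hij' hij
    obtain ⟨l', rfl⟩ := Multiset.exists_cons_of_mem hm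
    rw [Multiset.sum_cons] at hli
    have hk' : l'.sum = P.root k := by rw [hk, ← hli, add_sub_cancel_left]
    have hl' : ∀ y ∈ l', y ∈ P.root '' S := fun y hy => hl y (Multiset.mem_cons_of_mem hy)
    refine (P.isSubsystem_subsystemClosure S).2 k (ih ?_ l' hl' hk' (by simpa using hn)) j
      (P.subset_subsystemClosure S hj) i (by rw [hk]; abel)
    rw [← hk']
    exact AddSubmonoid.multiset_sum_mem _ _ fun y hy => AddSubmonoid.subset_closure (hl' y hy)

omit [Finite ι] in
theorem isSubsystem_rootsAt (t : P.Torus) : P.IsSubsystem (P.rootsAt t) := by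
  induction t using QuotientAddGroup.induction_on with
  | H h =>
    refine ⟨fun i hi j hj => ?_, fun i hi j hj k hk => ?_⟩
    · obtain ⟨n, hn⟩ := mem_rootsAt_mk_iff.mp hi
      refine mem_rootsAt_mk_iff.mpr ⟨-n, ?_⟩
      rw [root'] at hn ⊢
      rw [hj, map_neg, LinearMap.neg_apply, hn, Int.cast_neg]
    · obtain ⟨m, hm⟩ := mem_rootsAt_mk_iff.mp hi
      obtain ⟨n, hn⟩ := mem_rootsAt_mk_iff.mp hj
      refine mem_rootsAt_mk_iff.mpr ⟨m + n, ?_⟩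
      rw [root'] at hm hn ⊢
      rw [hk, map_add, LinearMap.add_apply, hm, hn, Int.cast_add]

omit [Finite ι] in
theorem rootsAt_smul (w : P.weylGroup) (t : P.Torus) :
    P.rootsAt (w • t) = P.weylGroupToPerm w '' P.rootsAt t := by
  ext i
  obtain ⟨j, rfl⟩ := (P.weylGroupToPerm w).surjective i
  rw [Equiv.injective _ |>.mem_set_image]
  change P.rootChar _ _ = 0 ↔ P.rootChar _ _ = 0
  rw [rootChar_smul]

omit [Finite ι] in
theorem Separates.rootsAt_smul {t : P.Torus} (ht : P.Separates (P.rootsAt t)) (w : P.weylGroup) :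
    P.Separates (P.rootsAt (w • t)) := by
  intro y hy
  rw [RootPairing.rootsAt_smul, Set.forall_mem_image] at hy
  refine (P.coweightAct w⁻¹).map_eq_zero_iff.mp (ht _ fun i hi => ?_)
  have h1 := P.toLinearMap_smul_coweightAct w⁻¹ (P.root (P.weylGroupToPerm w i)) y
  rw [← weylGroup_apply_root, inv_smul_smul, weylGroup_apply_root] at h1
  exact h1.trans (hy hi)

variable [P.IsRootSystem] [P.IsReduced] [P.IsIrreducible]

omit [Finite ι] [P.IsCrystallographic] [P.IsReduced] [P.IsIrreducible] in
theorem Base.coord_nonneg_of_mem_closure (b : P.Base) (j : b.support) {m : M}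
    (hm : m ∈ AddSubmonoid.closure (P.root '' b.support)) : 0 ≤ b.toWeightBasis.coord j m := by
  induction hm using AddSubmonoid.closure_induction with
  | mem m hm =>
    obtain ⟨i, hi, rfl⟩ := hm
    classical
    have := b.toWeightBasis_repr_root ⟨i, hi⟩
    simp only at this
    rw [Module.Basis.coord_apply, this, Finsupp.single_apply]
    split_ifs <;> simp
  | zero => simp
  | add x y _ _ hx hy => rw [map_add]; exact add_nonneg hx hy

/-- Every simple root occurs in α_0: the difference −α_j − α_0 has non-negative coordinates, so the
j-th coordinate of α_0 is at most −1. -/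
theorem Base.coord_lowestRoot_neg (b : P.Base) (j : b.support) :
    b.toWeightBasis.coord j (P.root b.lowestRoot) < 0 := by
  have h1 := b.coord_nonneg_of_mem_closure j (b.sub_lowestRoot_mem (P.reflectionPerm j j))
  have h2 : b.toWeightBasis.coord j (P.root j) = 1 := by
    rw [Module.Basis.coord_apply, b.toWeightBasis_repr_root, Finsupp.single_eq_same]
  rw [root_reflectionPerm, reflection_apply_self, map_sub, map_neg, h2] at h1
  have h3 : b.toWeightBasis.coord j (P.root b.lowestRoot) ≤ -1 := sub_nonneg.mp h1
  exact h3.trans_lt (by norm_num)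

omit [Finite ι] [P.IsCrystallographic] [P.IsReduced] [P.IsIrreducible] in
/-- The fundamental coweights. -/
theorem Base.exists_coweight (b : P.Base) (j : b.support) :
    ∃ x : N, ∀ m, P.toLinearMap m x = b.toWeightBasis.coord j m := by
  refine ⟨P.flip.toPerfPair.symm (b.toWeightBasis.coord j), fun m => ?_⟩
  exact LinearMap.congr_fun (P.flip.toPerfPair.apply_symm_apply (b.toWeightBasis.coord j)) m

theorem Base.exists_alcoveVertex (b : P.Base) (p : b.AffineVertex) :
    ∃ x : N, (∀ q ≠ p, P.affineEval x (P.affineRoot (b.affineSimple q)) = 0) ∧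
      0 < P.affineEval x (P.affineRoot (b.affineSimple p)) := by
  cases p with
  | none =>
    refine ⟨0, fun q hq => ?_, by simp [affineEval_affineRoot, affineSimple]⟩
    cases q with
    | none => exact absurd rfl hq
    | some j => simp [affineEval_affineRoot, affineSimple]
  | some j =>
    obtain ⟨x, hx⟩ := b.exists_coweight j
    have hneg := b.coord_lowestRoot_neg j
    set c := b.toWeightBasis.coord j (P.root b.lowestRoot) with hc
    have hself : ∀ k : b.support, b.toWeightBasis.coord j (P.root k) = Finsupp.single k 1 j := by
      intro k
      rw [Module.Basis.coord_apply, b.toWeightBasis_repr_root]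
    -- The fundamental coweight, rescaled so that α_0 takes the value −1.
    refine ⟨(-c)⁻¹ • x, fun q hq => ?_, ?_⟩
    · rw [affineEval_affineRoot, map_smul, root', hx]
      cases q with
      | none =>
        change (-c)⁻¹ * c + ((1 : ℤ) : ℂ) = 0
        rw [inv_neg, neg_mul, inv_mul_cancel₀ hneg.ne]
        simp
      | some k =>
        have hkj : k ≠ j := fun h => hq (by rw [h])
        change (-c)⁻¹ • b.toWeightBasis.coord j (P.root k) + ((0 : ℤ) : ℂ) = 0
        rw [hself, Finsupp.single_eq_of_ne hkj.symm]
        simp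
    · rw [affineEval_affineRoot, map_smul, root', hx]
      change 0 < (-c)⁻¹ • b.toWeightBasis.coord j (P.root j) + ((0 : ℤ) : ℂ)
      rw [hself, Finsupp.single_eq_same]
      simpa using RCLike.inv_pos_of_pos (neg_pos.mpr hneg)

/-- The vertex of the fundamental alcove opposite to the wall indexed by `p`. -/
def Base.alcoveVertex (b : P.Base) (p : b.AffineVertex) : N := (b.exists_alcoveVertex p).choose

theorem Base.affineEval_alcoveVertex_of_ne (b : P.Base) {p q : b.AffineVertex} (h : q ≠ p) :
    P.affineEval (b.alcoveVertex p) (P.affineRoot (b.affineSimple q)) = 0 :=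
  (b.exists_alcoveVertex p).choose_spec.1 q h

theorem Base.affineEval_alcoveVertex_self (b : P.Base) (p : b.AffineVertex) :
    0 < P.affineEval (b.alcoveVertex p) (P.affineRoot (b.affineSimple p)) :=
  (b.exists_alcoveVertex p).choose_spec.2

theorem Base.affineEval_alcoveVertex_eq_zero_iff (b : P.Base) {p q : b.AffineVertex} :
    P.affineEval (b.alcoveVertex p) (P.affineRoot (b.affineSimple q)) = 0 ↔ q ≠ p := by
  refine ⟨?_, b.affineEval_alcoveVertex_of_ne⟩
  rintro h rfl
  exact (b.affineEval_alcoveVertex_self q).ne' h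

theorem Base.alcoveVertex_mem_alcove (b : P.Base) (p : b.AffineVertex) :
    b.alcoveVertex p ∈ b.alcoveSystem.alcove := by
  intro q
  by_cases h : q = p
  · rw [h]; exact (b.affineEval_alcoveVertex_self p).le
  · exact (b.affineEval_alcoveVertex_of_ne h).ge

/-- All but one of the roots attached to the vertices of the affine diagram separate points. -/
theorem Base.separates_affineSimpleRoot_ne (b : P.Base) (p : b.AffineVertex) :
    P.Separates (b.affineSimpleRoot '' {q | q ≠ p}) := by
  intro x hx
  rw [Set.forall_mem_image] at hx
  cases p with
  | none => exact b.separates_support x fun i hi => hx (x := some ⟨i, hi⟩) (by simp)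
  | some j =>
    have hne : ∀ k : b.support, k ≠ j → P.root' k x = 0 := fun k hk =>
      hx (x := some k) (by simpa using hk)
    -- Once the other simple roots vanish at `x`, only the j-th coordinate of a weight matters, and
    -- that of α_0 is nonzero.
    have h1 : ∀ m, P.toLinearMap m x = b.toWeightBasis.coord j m * P.root' j x := by
      intro m
      conv_lhs => rw [← b.toWeightBasis.sum_repr m]
      rw [map_sum, LinearMap.sum_apply, Finset.sum_eq_single j]
      · simp [root']
      · intro k _ hk
        have := hne k hk
        rw [root'] at this
        simp [this]
      · simp
    have h2 : P.root' b.lowestRoot x = 0 := hx (x := none) (by simp)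
    rw [root', h1, mul_eq_zero, or_iff_right (b.coord_lowestRoot_neg j).ne] at h2
    refine b.separates_support x fun i _ => ?_
    rw [root', h1, h2, mul_zero]

theorem Base.affineEval_affineSimple (b : P.Base) (q : b.AffineVertex) (x : N) :
    P.affineEval x (P.affineRoot (b.affineSimple q)) =
      P.root' (b.affineSimpleRoot q) x + (b.affineSimple q).2 := by
  rw [affineEval_affineRoot, b.affineSimple_fst]

theorem Base.affineSimpleRoot_mem_rootsAt (b : P.Base) {q : b.AffineVertex} {x : N}
    (h : P.affineEval x (P.affineRoot (b.affineSimple q)) = 0) :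
    b.affineSimpleRoot q ∈ P.rootsAt (x : P.Torus) := by
  rw [affineEval_affineSimple] at h
  exact mem_rootsAt_mk_iff.mpr ⟨-(b.affineSimple q).2, by
    rw [Int.cast_neg, eq_neg_of_add_eq_zero_left h]⟩

/-- At a point of the alcove, the roots with integral values are sums of roots attached to walls
through the point, up to sign. -/
theorem Base.root_mem_closure_of_mem_rootsAt (b : P.Base) {x : N}
    (hx : x ∈ b.alcoveSystem.alcove) {i : ι} (hi : i ∈ P.rootsAt (x : P.Torus)) :
    P.root i ∈ AddSubmonoid.closure (P.root '' (b.affineSimpleRoot ''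
        {q | P.affineEval x (P.affineRoot (b.affineSimple q)) = 0})) ∨
      P.root (P.reflectionPerm i i) ∈ AddSubmonoid.closure (P.root '' (b.affineSimpleRoot ''
        {q | P.affineEval x (P.affineRoot (b.affineSimple q)) = 0})) := by
  have key : ∀ a, b.IsAffinePos a → P.affineEval x (P.affineRoot a) = 0 →
      P.root a.1 ∈ AddSubmonoid.closure (P.root '' (b.affineSimpleRoot ''
        {q | P.affineEval x (P.affineRoot (b.affineSimple q)) = 0})) := by
    intro a ha h0
    have h1 := (b.affineEval_nonneg_and_mem_closure hx (b.affineRoot_mem_closure ha)).2 h0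
    have h2 := AddSubmonoid.mem_map_of_mem (AddMonoidHom.fst M ℤ) h1
    rw [AddMonoidHom.map_mclosure, Set.image_image] at h2
    rw [Set.image_image]
    simp_rw [← b.affineSimple_fst]
    exact h2
  obtain ⟨n, hn⟩ := mem_rootsAt_mk_iff.mp hi
  -- α − n vanishes at `x`, and either it or its opposite is a positive affine root.
  rcases b.isAffinePos_or_neg (i, -n) with h | h
  · exact .inl (key _ h (by rw [affineEval_affineRoot]; simp [hn]))
  · refine .inr (key _ h ?_)
    have h3 : P.root' (P.reflectionPerm i i) x = -n := by
      rw [← hn]; simp [root']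
    rw [affineEval_affineRoot]
    simp [h3]

/-- The roots of the walls through x already separate points. Not all walls contain x, since the
simple ones force x = 0, where α_0 + 1 is 1. If walls p and q were both missed, the vertices
opposite to p and q would agree on the separating roots and coincide. So one wall p is missed, and x
solves the linear equations that define its opposite vertex. -/
theorem Base.eq_alcoveVertex_of_separates (b : P.Base) {x : N} (hx : x ∈ b.alcoveSystem.alcove)
    (hs : P.Separates (P.rootsAt (x : P.Torus))) : ∃ p, x = b.alcoveVertex p := by
  set Z := {q | P.affineEval x (P.affineRoot (b.affineSimple q)) = 0} with hZ
  have hsep : P.Separates (b.affineSimpleRoot '' Z) := by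
    refine fun y hy => hs y fun i hi => ?_
    have h1 : AddSubmonoid.closure (P.root '' (b.affineSimpleRoot '' Z)) ≤
        (LinearMap.ker (P.toLinearMap.flip y)).toAddSubmonoid := by
      rw [AddSubmonoid.closure_le]
      rintro _ ⟨j, hj, rfl⟩
      exact hy j hj
    rcases b.root_mem_closure_of_mem_rootsAt hx hi with h | h
    · exact h1 h
    · have h2 : P.toLinearMap (P.root (P.reflectionPerm i i)) y = 0 := h1 h
      rw [root_reflectionPerm, reflection_apply_self, map_neg, LinearMap.neg_apply,
        neg_eq_zero] at h2
      exact h2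
  obtain ⟨p, hp⟩ : ∃ p, p ∉ Z := by
    by_contra! h
    have h0 : x = 0 := b.separates_support x fun i hi => by
      simpa [affineEval_affineRoot, affineSimple, hZ] using h (some ⟨i, hi⟩)
    have := h none
    simp [hZ, h0, affineEval_affineRoot, affineSimple] at this
  have huniq : ∀ q ≠ p, q ∈ Z := by
    intro q hq
    by_contra hqZ
    have h1 : b.alcoveVertex p - b.alcoveVertex q = 0 := by
      refine hsep _ (Set.forall_mem_image.mpr fun r hr => ?_)
      have hrp : r ≠ p := fun h => hp (h ▸ hr)
      have hrq : r ≠ q := fun h => hqZ (h ▸ hr)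
      have h2 := b.affineEval_alcoveVertex_of_ne hrp
      have h3 := b.affineEval_alcoveVertex_of_ne hrq
      rw [affineEval_affineSimple] at h2 h3
      rw [map_sub]
      linear_combination h2 - h3
    have h4 := b.affineEval_alcoveVertex_of_ne hq
    rw [sub_eq_zero.mp h1] at h4
    exact (b.affineEval_alcoveVertex_self q).ne' h4
  refine ⟨p, sub_eq_zero.mp (b.separates_affineSimpleRoot_ne p _ ?_)⟩
  refine Set.forall_mem_image.mpr fun q hq => ?_
  have h2 : P.affineEval x (P.affineRoot (b.affineSimple q)) = 0 := huniq q hq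
  have h3 := b.affineEval_alcoveVertex_of_ne hq
  rw [affineEval_affineSimple] at h2 h3
  rw [map_sub]
  linear_combination h2 - h3

/-- Integral roots at the vertex are, up to sign, sums of the α_q with q ≠ p, hence lie in Φ_p.
Conversely, the integral roots form a subsystem containing these α_q. -/
theorem Base.rootsAt_alcoveVertex (b : P.Base) (p : b.AffineVertex) :
    P.rootsAt (b.alcoveVertex p : P.Torus) = b.subsystemAt p := by
  have hset : {q | P.affineEval (b.alcoveVertex p) (P.affineRoot (b.affineSimple q)) = 0} =
      {q | q ≠ p} := Set.ext fun q => b.affineEval_alcoveVertex_eq_zero_iff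
  refine Set.Subset.antisymm (fun i hi => ?_) ?_
  · have h1 := b.root_mem_closure_of_mem_rootsAt (b.alcoveVertex_mem_alcove p) hi
    rw [hset] at h1
    rcases h1 with h | h
    · exact mem_subsystemClosure_of_mem_closure h
    · exact (P.isSubsystem_subsystemClosure _).1 _ (mem_subsystemClosure_of_mem_closure h) i
        (by simp)
  · refine Set.sInter_subset_of_mem ⟨isSubsystem_rootsAt _, ?_⟩
    rintro _ ⟨q, hq, rfl⟩
    exact b.affineSimpleRoot_mem_rootsAt (b.affineEval_alcoveVertex_of_ne hq)

theorem Base.separates_rootsAt_alcoveVertex (b : P.Base) (p : b.AffineVertex) :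
    P.Separates (P.rootsAt (b.alcoveVertex p : P.Torus)) := by
  rw [b.rootsAt_alcoveVertex]
  exact (b.separates_affineSimpleRoot_ne p).mono (P.subset_subsystemClosure _)

omit [Finite ι] in
theorem smul_torus_eq_iff (P : RootPairing ι ℂ M N) (w : P.weylGroup) (x y : N) :
    w • (x : P.Torus) = (y : P.Torus) ↔ ∃ l ∈ P.corootLattice, y = P.coweightAct w x + l := by
  rw [smul_torus_mk, QuotientAddGroup.eq]
  constructor
  · intro h
    exact ⟨_, h, by abel⟩
  · rintro ⟨l, hl, rfl⟩
    rwa [neg_add_cancel_left]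

/-- Two points of the alcove that differ by an element of the affine Weyl group are equal. -/
theorem Base.eq_of_smul_torus_eq (b : P.Base) {x y : N} (hx : x ∈ b.alcoveSystem.alcove)
    (hy : y ∈ b.alcoveSystem.alcove) {w : P.weylGroup} (h : w • (x : P.Torus) = (y : P.Torus)) :
    x = y ∧ w ∈ Subgroup.closure ((fun q => weylGroup.ofIdx P (b.affineSimpleRoot q)) ''
      {q | P.affineEval x (P.affineRoot (b.affineSimple q)) = 0}) := by
  obtain ⟨l, hl, hyl⟩ := (P.smul_torus_eq_iff w x y).mp h
  -- The equality in the torus lifts to an affine Weyl group element taking `x` to `y`; its linear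
  -- part, being unique, is `w`.
  set g : Equiv.Perm N := Equiv.addRight l * (P.coweightAct w).toEquiv with hg
  have hgx : ∀ z, g z = P.coweightAct w z + l := fun z => rfl
  have hmem := b.mem_affineWeylGroup_of_eq w hl hgx
  have hgxy : g x = y := by rw [hgx, hyl]
  obtain ⟨h1, h2⟩ := b.alcoveSystem.apply_eq_of_mem_alcove hmem hx (by rwa [hgxy])
  refine ⟨by rw [← hgxy, h1], ?_⟩
  obtain ⟨w', hw', l', hl', hg'⟩ := b.exists_linear_part _ h2
  have h3 : l = l' := by
    have := (hgx 0).symm.trans (hg' 0)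
    simpa using this
  have h4 : w = w' := P.eq_of_coweightAct_eq fun z => by
    have := (hgx z).symm.trans (hg' z)
    rw [h3] at this
    exact add_right_cancel this
  rw [h4]
  exact hw'

theorem Base.stabilizer_alcoveVertex (b : P.Base) (p : b.AffineVertex) :
    MulAction.stabilizer P.weylGroup (b.alcoveVertex p : P.Torus) = b.weylGroupAt p := by
  have hset : {q | P.affineEval (b.alcoveVertex p) (P.affineRoot (b.affineSimple q)) = 0} =
      {q | q ≠ p} := Set.ext fun q => b.affineEval_alcoveVertex_eq_zero_iff
  refine le_antisymm (fun w hw => ?_) ?_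
  · have h1 := (b.eq_of_smul_torus_eq (b.alcoveVertex_mem_alcove p) (b.alcoveVertex_mem_alcove p)
      (MulAction.mem_stabilizer_iff.mp hw)).2
    rwa [hset] at h1
  · rw [weylGroupAt, Subgroup.closure_le]
    rintro _ ⟨q, hq, rfl⟩
    obtain ⟨n, hn⟩ := mem_rootsAt_mk_iff.mp
      (b.affineSimpleRoot_mem_rootsAt (b.affineEval_alcoveVertex_of_ne hq))
    refine MulAction.mem_stabilizer_iff.mpr ((P.smul_torus_eq_iff _ _ _).mpr
      ⟨n • P.coroot (b.affineSimpleRoot q),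
        zsmul_mem (AddSubgroup.subset_closure (Set.mem_range_self _)) n, ?_⟩)
    rw [coweightAct_ofIdx, hn, Int.cast_smul_eq_zsmul, sub_add_cancel]

-- Because the roots are real at `x`, α + k can fail to be ≥ 0 only when k is below −α(x), and
-- positivity requires k ≥ 0.
omit [P.IsCrystallographic] [P.IsRootSystem] [P.IsReduced] [P.IsIrreducible] in
theorem Base.finite_setOf_isAffinePos_not_nonneg (b : P.Base) {x : N}
    (hx : ∀ i, (P.root' i x).im = 0) :
    {a | b.IsAffinePos a ∧ ¬ 0 ≤ P.affineEval x (P.affineRoot a)}.Finite := by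
  have hsub : {a | b.IsAffinePos a ∧ ¬ 0 ≤ P.affineEval x (P.affineRoot a)} ⊆
      ⋃ i : ι, (fun k : ℤ => (i, k)) '' Set.Icc 0 ⌈-(P.root' i x).re⌉ := by
    rintro ⟨i, k⟩ ⟨ha, hk⟩
    refine Set.mem_iUnion.mpr ⟨i, k, ⟨?_, ?_⟩, rfl⟩
    · rcases ha with h | ⟨h, -⟩
      · exact h.le
      · exact h.ge
    · by_contra! h
      apply hk
      have h1 := (Int.le_ceil _).trans_lt (Int.cast_lt.mpr h)
      rw [affineEval_affineRoot, Complex.nonneg_iff]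
      simp only [Complex.add_re, Complex.intCast_re, Complex.add_im, Complex.intCast_im, hx]
      exact ⟨by linarith, by simp⟩
  exact (Set.finite_iUnion fun i => (Set.finite_Icc _ _).image _).subset hsub

/-- The separation condition is W-invariant, so values stay real along the whole affine orbit; this
supplies the comparability needed to move a lift into the alcove, where it must be a vertex. -/
theorem Base.exists_smul_alcoveVertex_eq (b : P.Base) {t : P.Torus}
    (ht : P.Separates (P.rootsAt t)) :
    ∃ (p : b.AffineVertex) (w : P.weylGroup), w • t = (b.alcoveVertex p : P.Torus) := by
  induction t using QuotientAddGroup.induction_on with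
  | H x =>
  have hmove : ∀ g ∈ Subgroup.closure (Set.range b.alcoveSystem.s), ∃ w : P.weylGroup,
      w • (x : P.Torus) = (g x : P.Torus) := by
    intro g hg
    rw [← Set.image_univ] at hg
    obtain ⟨w, -, l, hl, hgw⟩ := b.exists_linear_part _ hg
    exact ⟨w, (P.smul_torus_eq_iff _ _ _).mpr ⟨l, hl, hgw x⟩⟩
  have hsep : ∀ g ∈ Subgroup.closure (Set.range b.alcoveSystem.s),
      P.Separates (P.rootsAt (g x : P.Torus)) := by
    intro g hg
    obtain ⟨w, hw⟩ := hmove g hg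
    rw [← hw]
    exact ht.rootsAt_smul w
  obtain ⟨g, hg, hgx⟩ := b.alcoveSystem.exists_apply_mem_alcove x (by
    rintro q _ ⟨g, hg, rfl⟩
    have h1 := im_root'_eq_zero b (hsep g hg) (b.affineSimple q).1
    change 0 ≤ P.affineEval (g x) (P.affineRoot (b.affineSimple q)) ∨
      P.affineEval (g x) (P.affineRoot (b.affineSimple q)) ≤ 0
    rw [affineEval_affineRoot, Complex.nonneg_iff, Complex.nonpos_iff]
    simp only [Complex.add_im, Complex.intCast_im, h1]
    simpa using le_total _ _)
    (b.finite_setOf_isAffinePos_not_nonneg (im_root'_eq_zero b ht))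
  obtain ⟨p, hp⟩ := b.eq_alcoveVertex_of_separates hgx (hsep g hg)
  obtain ⟨w, hw⟩ := hmove g hg
  exact ⟨p, w, by rw [hw, hp]⟩

end Vertices

end RootPairing

end

/-! ### The orbit bijection and the count. -/

noncomputable section

namespace RootPairing

section Orbits

variable {ι M N : Type*} [Finite ι] [AddCommGroup M] [Module ℂ M] [AddCommGroup N] [Module ℂ N]
  {P : RootPairing ι ℂ M N} [P.IsCrystallographic] [P.IsRootSystem] [P.IsReduced] [P.IsIrreducible]

theorem Base.finite_setOf_separates (b : P.Base) :
    {t : P.Torus | P.Separates (P.rootsAt t)}.Finite := by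
  have := P.finite_weylGroup
  refine (Set.finite_range fun x : b.AffineVertex × P.weylGroup =>
    x.2⁻¹ • (b.alcoveVertex x.1 : P.Torus)).subset fun t ht => ?_
  obtain ⟨p, w, hw⟩ := b.exists_smul_alcoveVertex_eq ht
  exact ⟨(p, w), inv_smul_eq_iff.mpr hw.symm⟩

variable [TopologicalSpace N] [IsTopologicalAddGroup N] [ContinuousSMul ℂ N] [T2Space N]

theorem Base.mem_points_iff (b : P.Base) {t : P.Torus} :
    t ∈ P.points ↔ P.Separates (P.rootsAt t) :=
  ⟨separates_rootsAt_of_isLayer, b.isLayer_of_separates b.finite_setOf_separates⟩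

theorem Base.finite_points (b : P.Base) : Finite P.points :=
  (b.finite_setOf_separates.subset fun _ ht => b.mem_points_iff.mp ht).to_subtype

/-- The point of `C₀(Φ)` given by a vertex of the fundamental alcove. -/
def Base.vertexPoint (b : P.Base) (p : b.AffineVertex) : P.points :=
  ⟨(b.alcoveVertex p : P.Torus), b.mem_points_iff.mpr (b.separates_rootsAt_alcoveVertex p)⟩

/-- The bijection between the vertices of the affine Dynkin diagram and the orbits of `C₀(Φ)`. -/
def Base.orbitEquiv (b : P.Base) :
    b.AffineVertex ≃ MulAction.orbitRel.Quotient P.weylGroup P.points :=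
  Equiv.ofBijective (fun p => Quotient.mk _ (b.vertexPoint p)) <| by
    constructor
    · intro p q h
      obtain ⟨w, hw⟩ := MulAction.orbitRel_apply.mp (Quotient.exact h)
      have h1 := (b.eq_of_smul_torus_eq (b.alcoveVertex_mem_alcove q) (b.alcoveVertex_mem_alcove p)
        (congrArg Subtype.val hw)).1
      by_contra hpq
      have h2 := b.affineEval_alcoveVertex_of_ne hpq
      rw [h1, b.affineEval_alcoveVertex_eq_zero_iff] at h2
      exact h2 rfl
    · intro ω
      induction ω using Quotient.inductionOn with
      | h t =>
        obtain ⟨p, w, hw⟩ := b.exists_smul_alcoveVertex_eq (b.mem_points_iff.mp t.2)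
        exact ⟨p, Quotient.sound (MulAction.orbitRel_apply.mpr ⟨w, Subtype.ext hw⟩)⟩

theorem Base.stabilizer_vertexPoint (b : P.Base) (p : b.AffineVertex) :
    MulAction.stabilizer P.weylGroup (b.vertexPoint p) = b.weylGroupAt p := by
  rw [SubMulAction.stabilizer_of_subMul]
  exact b.stabilizer_alcoveVertex p

theorem Base.card_points (b : P.Base) : (Nat.card P.points : ℚ) =
    ∑ p : b.AffineVertex, (Nat.card P.weylGroup : ℚ) / (Nat.card (b.weylGroupAt p) : ℚ) := by
  have := P.finite_weylGroup
  -- Alcove vertices serve as orbit representatives, so that the stabilizers are the W_p themselves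
  -- and not merely conjugates.
  let φ : MulAction.orbitRel.Quotient P.weylGroup P.points → P.points :=
    fun ω => b.vertexPoint (b.orbitEquiv.symm ω)
  have hφ : Function.LeftInverse Quotient.mk'' φ := b.orbitEquiv.apply_symm_apply
  have := Fintype.ofEquiv _ b.orbitEquiv
  rw [Nat.card_congr (MulAction.selfEquivSigmaOrbitsQuotientStabilizer' P.weylGroup P.points hφ),
    Nat.card_sigma, Nat.cast_sum, ← b.orbitEquiv.sum_comp]
  refine Finset.sum_congr rfl fun p _ => ?_
  have h1 : MulAction.stabilizer P.weylGroup (φ (b.orbitEquiv p)) = b.weylGroupAt p := by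
    simp only [φ, Equiv.symm_apply_apply, b.stabilizer_vertexPoint]
  rw [h1, eq_div_iff (by exact_mod_cast Nat.card_pos.ne')]
  exact_mod_cast (Subgroup.card_eq_card_quotient_mul_card_subgroup _).symm

end Orbits

end RootPairing

end

theorem theorem1 {ι M N : Type*} [Finite ι] [AddCommGroup M] [Module ℂ M]
    [AddCommGroup N] [Module ℂ N] [TopologicalSpace N] [IsTopologicalAddGroup N]
    [ContinuousSMul ℂ N] [T2Space N]
    (P : RootPairing ι ℂ M N) [P.IsRootSystem] [P.IsCrystallographic] [P.IsReduced]
    [P.IsIrreducible] (b : P.Base) :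
    (∃ e : b.AffineVertex ≃ MulAction.orbitRel.Quotient P.weylGroup P.points,
      ∀ (p : b.AffineVertex) (t : P.points), Quotient.mk _ t = e p →
        (∃ w : P.weylGroup, P.weylGroupToPerm w '' P.rootsAt (t : P.Torus) = b.subsystemAt p) ∧
        (∃ w : P.weylGroup,
          (MulAction.stabilizer P.weylGroup (t : P.Torus)).map (MulAut.conj w).toMonoidHom =
            b.weylGroupAt p)) ∧
    Finite P.points ∧
    (Nat.card P.points : ℚ) =
      ∑ p : b.AffineVertex, (Nat.card P.weylGroup : ℚ) / (Nat.card (b.weylGroupAt p) : ℚ) := by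
  refine ⟨⟨b.orbitEquiv, fun p t ht => ?_⟩, b.finite_points, b.card_points⟩
  -- The element carrying t to the alcove vertex conjugates both Φ(t) and W(t).
  obtain ⟨w, hw⟩ := MulAction.orbitRel_apply.mp (Quotient.exact ht.symm)
  have hwt : w • (t : P.Torus) = (b.alcoveVertex p : P.Torus) := congrArg Subtype.val hw
  refine ⟨⟨w, ?_⟩, ⟨w, ?_⟩⟩
  · rw [← RootPairing.rootsAt_smul, hwt, b.rootsAt_alcoveVertex]
  · rw [← b.stabilizer_alcoveVertex, ← hwt, MulAction.stabilizer_smul_eq_stabilizer_map_conj]
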